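/- Let $\mathcal H\neq 0$ be a complex separable Hilbert space and $1\le p<\infty$. For a bounded operator $A$ on $\mathcal H$ put $|A|=(A^{*}A)^{1/2}$, and let $\mathcal J_p$ be the Schatten class of all bounded operators $A$ on $\mathcal H$ such that $|A|^p$ is trace class, with the norm $\|A\|_p=(\operatorname{tr}|A|^p)^{1/p}$. Let $\phi:\mathcal J_p\to\mathcal J_p$ be a linear map which is 2-positive, i.e. for all $A_{11},A_{12},A_{21},A_{22}\in\mathcal J_p$ such that the block operator $(A_{ij})_{i,j=1,2}$ on $\mathcal H\oplus\mathcal H$ is nonnegative, the block operator $(\phi(A_{ij}))_{i,j=1,2}$ is nonnegative. Let $\|\phi\|_p=\sup_{\|A\|_p\le 1}\|\phi(A)\|_p$ be its operator norm and $r_p(\phi)=\lim_{n\to\infty}\|\phi^n\|_p^{1/n}$ its spectral radius, and assume that $r_p(\phi)=\|\phi\|_p$. 1. If $\lambda\in\mathbb C$ satisfies $|\lambda|=r_p(\phi)$ and $0\ne A\in\mathcal J_p$ satisfies $\phi(A)=\lambda A$, then $|A|\neq 0$ and $\phi(|A|)=r_p(\phi)\,|A|$, i.e. $r_p(\phi)$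 is also an eigenvalue of $\phi$, with eigenvector $|A|$. 2. In particular, if $\phi$ is in addition compact as a map in $\mathcal J_p$, then $r_p(\phi)$ is an eigenvalue of $\phi$. -/

import Mathlib

open scoped ComplexOrder InnerProductSpace ENNReal

set_option linter.unusedSectionVars false

namespace Schatten

universe u

variable {H : Type u} [NormedAddCommGroup H] [InnerProductSpace ℂ H] [CompleteSpace H]

section
variable (H)
/-- The index set of a fixed Hilbert basis of `H`. -/
def basisIndex : Set H := (exists_hilbertBasis ℂ H).choose

/-- A fixed Hilbert basis of `H`. -/
noncomputable def basis : HilbertBasis (basisIndex H) ℂ H :=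
  (exists_hilbertBasis ℂ H).choose_spec.choose
end

/-- The trace `∑ i, ⟨b i, T (b i)⟩ ∈ [0, ∞]` of a bounded operator `T ≥ 0`. It is computed in a fixed
Hilbert basis; `posTrace_eq` below shows that the choice does not matter. -/
noncomputable def posTrace (T : H →L[ℂ] H) : ℝ≥0∞ :=
  ∑' i, ENNReal.ofReal (⟪basis H i, T (basis H i)⟫_ℂ).re

theorem parseval {ι : Type*} (b : HilbertBasis ι ℂ H) (x : H) :
    ∑' i, ‖⟪b i, x⟫_ℂ‖ₑ ^ 2 = ‖x‖ₑ ^ 2 := by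
  have h := b.hasSum_inner_mul_inner x x
  have h2 : HasSum (fun i => ‖⟪b i, x⟫_ℂ‖ ^ 2) (‖x‖ ^ 2) := by
    have h3 := Complex.hasSum_re h
    convert h3 using 1
    · ext i
      rw [← inner_conj_symm x (b i), ← Complex.normSq_eq_conj_mul_self, Complex.normSq_eq_norm_sq]
      norm_cast
    · rw [inner_self_eq_norm_sq_to_K]; norm_cast
  have h4 : ∀ y : ℂ, ‖y‖ₑ ^ 2 = ENNReal.ofReal (‖y‖ ^ 2) := fun y => by
    rw [ENNReal.ofReal_pow (norm_nonneg _), ofReal_norm]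
  simp_rw [h4]
  rw [← ENNReal.ofReal_tsum_of_nonneg (fun _ => by positivity) h2.summable, h2.tsum_eq,
    ENNReal.ofReal_pow (norm_nonneg _), ofReal_norm]

theorem bessel {ι : Type*} {v : ι → H} (hv : Orthonormal ℂ v) (x : H) :
    ∑' i, ‖⟪v i, x⟫_ℂ‖ₑ ^ 2 ≤ ‖x‖ₑ ^ 2 := by
  rw [ENNReal.tsum_eq_iSup_sum]
  refine iSup_le fun s => ?_
  have h := hv.sum_inner_products_le x (s := s)
  have h4 : ∀ y : ℂ, ‖y‖ₑ ^ 2 = ENNReal.ofReal (‖y‖ ^ 2) := fun y => by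
    rw [ENNReal.ofReal_pow (norm_nonneg _), ofReal_norm]
  simp_rw [h4]
  rw [← ENNReal.ofReal_sum_of_nonneg (fun _ _ => by positivity), ← ofReal_norm,
    ← ENNReal.ofReal_pow (norm_nonneg _)]
  exact ENNReal.ofReal_le_ofReal h

theorem hs_swap {ι κ : Type*} (b : HilbertBasis ι ℂ H) (c : HilbertBasis κ ℂ H)
    (S : H →L[ℂ] H) :
    ∑' i, ‖S (b i)‖ₑ ^ 2 = ∑' j, ‖(star S) (c j)‖ₑ ^ 2 := by
  simp_rw [← parseval c (S _), ← parseval b ((star S) _)]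
  rw [ENNReal.tsum_comm]
  congr! 5 with j i
  rw [ContinuousLinearMap.star_eq_adjoint, ContinuousLinearMap.adjoint_inner_right,
    ← inner_conj_symm]
  exact RCLike.enorm_conj _

theorem inner_eq_sqrt {T : H →L[ℂ] H} (hT : 0 ≤ T) (x : H) :
    ENNReal.ofReal (⟪x, T x⟫_ℂ).re = ‖CFC.sqrt T x‖ₑ ^ 2 := by
  have h1 : CFC.sqrt T * CFC.sqrt T = T := CFC.sqrt_mul_sqrt_self T
  have h2 : star (CFC.sqrt T) = CFC.sqrt T := (CFC.sqrt_nonneg T).isSelfAdjoint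
  conv_lhs => rw [← h1]
  rw [mul_apply_eq_comp, ← ContinuousLinearMap.adjoint_inner_left,
    ← ContinuousLinearMap.star_eq_adjoint, h2, inner_self_eq_norm_sq_to_K, ← ofReal_norm,
    ← ENNReal.ofReal_pow (norm_nonneg _)]
  norm_cast

theorem posTrace_eq {ι : Type*} (b : HilbertBasis ι ℂ H) {T : H →L[ℂ] H} (hT : 0 ≤ T) :
    posTrace T = ∑' i, ENNReal.ofReal (⟪b i, T (b i)⟫_ℂ).re := by
  have h2 : star (CFC.sqrt T) = CFC.sqrt T := (CFC.sqrt_nonneg T).isSelfAdjoint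
  simp_rw [posTrace, inner_eq_sqrt hT]
  rw [hs_swap (basis H) b, h2]

open Classical in
theorem compact_of_hs {S : H →L[ℂ] H} (hS : ∑' i, ‖(star S) (basis H i)‖ₑ ^ 2 ≠ ⊤) :
    IsCompactOperator S := by
  set b := basis H
  let F : Finset (basisIndex H) → (H →L[ℂ] H) := fun s =>
    ∑ i ∈ s, (innerSL ℂ ((star S) (b i))).smulRight (b i)
  have hF : ∀ s x i, ⟪b i, (S - F s) x⟫_ℂ = if i ∈ s then 0 else ⟪(star S) (b i), x⟫_ℂ := by
    intro s x i
    have : ∀ j, ⟪b i, b j⟫_ℂ = if i = j then 1 else 0 := fun j =>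
      orthonormal_iff_ite.mp b.orthonormal i j
    simp only [F, sub_apply, sum_apply, inner_sub_right,
      inner_sum, ContinuousLinearMap.smulRight_apply, innerSL_apply_apply, inner_smul_right, this,
      ContinuousLinearMap.star_eq_adjoint, ContinuousLinearMap.adjoint_inner_left]
    split_ifs with h <;> simp [h]
  have hb : ∀ s x, ‖(S - F s) x‖ₑ ^ 2 ≤
      (∑' i : {i // i ∉ s}, ‖(star S) (b i)‖ₑ ^ 2) * ‖x‖ₑ ^ 2 := by
    intro s x
    rw [← parseval b, ← ENNReal.tsum_mul_right]
    have h0 := tsum_subtype {i | i ∉ s} (fun i => ‖(star S) (b i)‖ₑ ^ 2 * ‖x‖ₑ ^ 2)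
    refine le_trans ?_ h0.ge
    refine ENNReal.tsum_le_tsum fun i => ?_
    rw [hF]
    by_cases h : i ∈ s
    · simp [h]
    · simp only [h, if_false, Set.indicator, Set.mem_ofPred_eq, not_false_eq_true, if_true]
      rw [← mul_pow]
      gcongr
      simp only [← ofReal_norm]
      rw [← ENNReal.ofReal_mul (norm_nonneg _)]
      exact ENNReal.ofReal_le_ofReal (norm_inner_le_norm _ _)
  have ht := ENNReal.tendsto_tsum_compl_atTop_zero hS
  have hfin : ∀ s : Finset (basisIndex H), (∑' i : {i // i ∉ s}, ‖(star S) (b i)‖ₑ ^ 2) ≠ ⊤ :=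
    fun s => ne_top_of_le_ne_top hS
      (ENNReal.tsum_comp_le_tsum_of_injective Subtype.val_injective _)
  have hn : ∀ s, ‖F s - S‖ ≤ √(∑' i : {i // i ∉ s}, ‖(star S) (b i)‖ₑ ^ 2).toReal := by
    intro s
    rw [norm_sub_rev]
    refine ContinuousLinearMap.opNorm_le_bound _ (Real.sqrt_nonneg _) fun x => ?_
    refine abs_le_of_sq_le_sq' ?_ (by positivity) |>.2
    rw [mul_pow, Real.sq_sqrt ENNReal.toReal_nonneg]
    have := ENNReal.toReal_mono (by finiteness [hfin s]) (hb s x)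
    simpa [ENNReal.toReal_mul, ENNReal.toReal_pow] using this
  refine isCompactOperator_of_tendsto (F := F) (l := Filter.atTop) ?_ (.of_forall fun s => ?_)
  · rw [tendsto_iff_norm_sub_tendsto_zero]
    refine squeeze_zero (fun _ => norm_nonneg _) hn ?_
    have h1 := (ENNReal.tendsto_toReal ENNReal.zero_ne_top).comp ht
    have h2 := (Real.continuous_sqrt.tendsto _).comp h1
    rw [ENNReal.toReal_zero, Real.sqrt_zero] at h2
    exact h2
  · refine Finset.sum_induction _ (fun T : H →L[ℂ] H => IsCompactOperator T)
      (fun _ _ h1 h2 => IsCompactOperator.add h1 h2) isCompactOperator_zero fun i _ => ?_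
    have h1 : IsCompactOperator (ContinuousLinearMap.toSpanSingleton ℂ (b i)) :=
      isCompactOperator_of_locallyCompactSpace_rng _
    exact h1.comp_clm (innerSL ℂ ((star S) (b i)))

theorem compact_of_posTrace {T : H →L[ℂ] H} (hT : 0 ≤ T) (h : posTrace T ≠ ⊤) :
    IsCompactOperator T := by
  have h1 : CFC.sqrt T * CFC.sqrt T = T := CFC.sqrt_mul_sqrt_self T
  have h2 : star (CFC.sqrt T) = CFC.sqrt T := (CFC.sqrt_nonneg T).isSelfAdjoint
  have h3 : IsCompactOperator ⇑(CFC.sqrt T) := by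
    apply compact_of_hs
    rw [h2]
    simpa only [posTrace, inner_eq_sqrt hT] using h
  have h4 : IsCompactOperator ⇑(CFC.sqrt T * CFC.sqrt T) := IsCompactOperator.comp_clm h3 (CFC.sqrt T)
  rwa [h1] at h4

theorem compact_of_bound {A B : H →L[ℂ] H} (hB : IsCompactOperator B)
    (h : ∀ x, ‖A x‖ ^ 2 ≤ ‖B x‖ * ‖x‖) : IsCompactOperator A := by
  have hB' := (isCompactOperator_iff_isCompact_closure_image_ball (B : H →ₗ[ℂ] H) one_pos).mp hB
  refine (isCompactOperator_iff_isCompact_closure_image_ball (A : H →ₗ[ℂ] H) one_pos).mpr ?_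
  have hB'' : TotallyBounded (B '' Metric.ball 0 1) := hB'.totallyBounded.subset subset_closure
  refine TotallyBounded.isCompact_of_isClosed (TotallyBounded.closure ?_) isClosed_closure
  rw [Metric.totallyBounded_iff]
  intro ε hε
  obtain ⟨t, hts, htf, htc⟩ := Metric.finite_approx_of_totallyBounded hB'' (ε ^ 2 / 2) (by positivity)
  have hts' : ∀ y : H, y ∈ t → ∃ x, x ∈ Metric.ball (0 : H) 1 ∧ B x = y := fun y hy => hts hy
  choose! g hg1 hg2 using hts'
  refine ⟨(fun y => A (g y)) '' t, htf.image _, ?_⟩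
  rintro _ ⟨x, hx, rfl⟩
  obtain ⟨y, hy, hxy⟩ := Set.mem_iUnion₂.mp (htc ⟨x, hx, rfl⟩)
  refine Set.mem_iUnion₂.mpr ⟨_, ⟨y, hy, rfl⟩, ?_⟩
  have hgy := hg1 y hy
  rw [Metric.mem_ball, dist_eq_norm, ← hg2 y hy, ← map_sub] at hxy
  rw [mem_ball_zero_iff] at hx hgy
  change A x ∈ Metric.ball (A (g y)) ε
  rw [Metric.mem_ball, dist_eq_norm, ← map_sub]
  have h2 : ‖x - g y‖ ≤ 2 := (norm_sub_le _ _).trans (by linarith)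
  have h3 := h (x - g y)
  have h4 : ‖B (x - g y)‖ * ‖x - g y‖ ≤ ‖B (x - g y)‖ * 2 := by gcongr
  exact lt_of_pow_lt_pow_left₀ 2 hε.le (by linarith)

theorem cfc_eigen {T : H →L[ℂ] H} (hT : IsSelfAdjoint T) {x : H} {μ : ℝ} (hx : x ≠ 0)
    (h : T x = (μ : ℂ) • x) (f : ℝ → ℝ) (hf : ContinuousOn f (spectrum ℝ T)) :
    cfc f T x = (f μ : ℂ) • x := by
  have hμ : μ ∈ spectrum ℝ T := by
    rw [spectrum.mem_iff]
    intro hu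
    obtain ⟨v, hv⟩ := hu.exists_left_inv
    apply hx
    have : (v * ((algebraMap ℝ (H →L[ℂ] H)) μ - T)) x = x := by rw [hv]; rfl
    rw [← this, mul_apply_eq_comp]
    simp [Algebra.algebraMap_eq_smul_one, h]
  have key : ∀ g : C(spectrum ℝ T, ℝ), cfcHom hT g x = ((g ⟨μ, hμ⟩ : ℝ) : ℂ) • x := by
    intro g
    induction g using ContinuousMap.induction_on_of_compact with
    | const r =>
      have : ContinuousMap.const (spectrum ℝ T) r = algebraMap ℝ C(spectrum ℝ T, ℝ) r := rfl
      rw [this, AlgHomClass.commutes]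
      simp [Algebra.algebraMap_eq_smul_one]
    | id => rw [cfcHom_id hT]; simpa using h
    | star_id => rw [map_star, cfcHom_id, hT.star_eq]; simpa using h
    | add f g hf hg => rw [map_add]; simp [hf, hg, add_smul]
    | mul f g hf hg =>
      rw [map_mul, mul_apply_eq_comp, hg, map_smul, hf, smul_smul, ContinuousMap.mul_apply, mul_comm,
        Complex.ofReal_mul]
    | frequently f hf =>
      have hc : Continuous fun g : C(spectrum ℝ T, ℝ) => cfcHom hT g x :=
        (ContinuousLinearMap.apply ℂ H x).continuous.comp (cfcHom_continuous hT)
      have hc2 : Continuous fun g : C(spectrum ℝ T, ℝ) => ((g ⟨μ, hμ⟩ : ℝ) : ℂ) • x := by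
        fun_prop
      exact (isClosed_eq hc hc2).mem_of_frequently_of_tendsto hf Filter.tendsto_id
  rw [cfc_apply f T hT hf, key]
  rfl

theorem rpow_eigen {T : H →L[ℂ] H} (hT : 0 ≤ T) {x : H} {μ : ℝ} (hx : x ≠ 0)
    (h : T x = (μ : ℂ) • x) {p : ℝ} (hp : 0 ≤ p) : (T ^ p) x = ((μ ^ p : ℝ) : ℂ) • x := by
  rw [CFC.rpow_eq_cfc_real hT]
  exact cfc_eigen hT.isSelfAdjoint hx h _ (Real.continuous_rpow_const hp).continuousOn

theorem exists_basis_of_family {V : ℂ → Submodule ℂ H} (hV : ∀ μ, IsClosed (V μ : Set H))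
    (ho : OrthogonalFamily ℂ (fun μ => V μ) fun μ => (V μ).subtypeₗᵢ) (hs : (⨆ μ, V μ)ᗮ = ⊥) :
    ∃ (ι : Type u) (b : HilbertBasis ι ℂ H) (μ : ι → ℂ), ∀ i, b i ∈ V (μ i) := by
  have hcl : ∀ μ, CompleteSpace (V μ) := fun μ => (hV μ).completeSpace_coe
  choose w c hcw using fun μ => exists_hilbertBasis ℂ (V μ)
  have ho' : Orthonormal ℂ (fun a : (Σ μ, w μ) => (c a.1 a.2 : H)) :=
    ho.orthonormal_sigma_orthonormal (fun μ => (c μ).orthonormal)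
  have hsp : (Submodule.span ℂ (Set.range fun a : (Σ μ, w μ) => (c a.1 a.2 : H)))ᗮ = ⊥ := by
    rw [eq_bot_iff, ← hs]
    intro x hx
    rw [← Submodule.iInf_orthogonal, Submodule.mem_iInf]
    intro μ
    rw [Submodule.mem_orthogonal]
    intro u hu
    have hd : (⊤ : Submodule ℂ (V μ)) ≤
        LinearMap.ker ((innerSL ℂ x).comp (V μ).subtypeL).toLinearMap := by
      rw [← (c μ).dense_span]
      refine Submodule.topologicalClosure_minimal _ ?_ (ContinuousLinearMap.isClosed_ker _)
      rw [Submodule.span_le]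
      rintro _ ⟨i, rfl⟩
      have := (Submodule.mem_orthogonal _ _).mp hx _ (Submodule.subset_span ⟨⟨μ, i⟩, rfl⟩)
      exact inner_eq_zero_symm.mp this
    have h3 : (⟨u, hu⟩ : V μ) ∈ LinearMap.ker ((innerSL ℂ x).comp (V μ).subtypeL).toLinearMap :=
      hd trivial
    exact inner_eq_zero_symm.mp h3
  refine ⟨_, HilbertBasis.mkOfOrthogonalEqBot ho' hsp, fun a => a.1, fun a => ?_⟩
  rw [HilbertBasis.coe_mkOfOrthogonalEqBot]
  exact (c a.1 a.2).2

open Module.End in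
theorem exists_eigenbasis {T : H →L[ℂ] H} (hT : 0 ≤ T) (hc : IsCompactOperator T) :
    ∃ (ι : Type u) (b : HilbertBasis ι ℂ H) (μ : ι → ℝ),
      ∀ i, 0 ≤ μ i ∧ T (b i) = (μ i : ℂ) • b i := by
  have hs : (T : H →ₗ[ℂ] H).IsSymmetric := hT.isSelfAdjoint.isSymmetric
  have hcl : ∀ μ, IsClosed ((eigenspace (T : H →ₗ[ℂ] H) μ : Submodule ℂ H) : Set H) := fun μ => by
    have h : ((eigenspace (T : H →ₗ[ℂ] H) μ : Submodule ℂ H) : Set H) = {x | T x = μ • x} := by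
      ext x; simp
    rw [h]
    exact isClosed_eq T.continuous (by fun_prop)
  obtain ⟨ι, b, μ, hb⟩ := exists_basis_of_family hcl hs.orthogonalFamily_eigenspaces
    (T.orthogonalComplement_iSup_eigenspaces_eq_bot hc hs)
  refine ⟨ι, b, fun i => (μ i).re, fun i => ?_⟩
  have hv : T (b i) = μ i • b i := mem_eigenspace_iff.mp (hb i)
  have hn : ‖b i‖ = 1 := b.orthonormal.1 i
  have hpos := ((ContinuousLinearMap.nonneg_iff_isPositive T).mp hT).inner_nonneg_right (b i)
  rw [hv, inner_smul_right, inner_self_eq_norm_sq_to_K, hn] at hpos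
  have h0 : (0 : ℂ) ≤ μ i := by simpa using hpos
  have h1 : (((μ i).re : ℝ) : ℂ) = μ i := Complex.ext rfl (by simpa using (Complex.le_def.mp h0).2)
  exact ⟨(Complex.le_def.mp h0).1, by rw [hv, h1]⟩

theorem norm_abs_apply (A : H →L[ℂ] H) (x : H) : ‖CFC.abs A x‖ = ‖A x‖ := by
  have h1 : ∀ B : H →L[ℂ] H, ‖B x‖ ^ 2 = (⟪x, (star B * B) x⟫_ℂ).re := fun B => by
    rw [mul_apply_eq_comp, ContinuousLinearMap.star_eq_adjoint,
      ContinuousLinearMap.adjoint_inner_right, inner_self_eq_norm_sq_to_K]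
    norm_cast
  have h2 : star (CFC.abs A) = CFC.abs A := (CFC.abs_nonneg A).isSelfAdjoint
  have h3 : ‖CFC.abs A x‖ ^ 2 = ‖A x‖ ^ 2 := by rw [h1, h1, h2, CFC.abs_mul_abs]
  exact (pow_left_inj₀ (norm_nonneg _) (norm_nonneg _) two_ne_zero).mp h3

theorem compact_abs {A : H →L[ℂ] H} (h : IsCompactOperator A) : IsCompactOperator ⇑(CFC.abs A) := by
  have : IsCompactOperator ⇑(CFC.abs A * CFC.abs A) := by
    rw [CFC.abs_mul_abs]
    exact h.clm_comp (star A)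
  refine compact_of_bound this fun x => ?_
  have h2 : star (CFC.abs A) = CFC.abs A := (CFC.abs_nonneg A).isSelfAdjoint
  have h3 : ‖CFC.abs A x‖ ^ 2 = (⟪x, (CFC.abs A * CFC.abs A) x⟫_ℂ).re := by
    rw [mul_apply_eq_comp, ← ContinuousLinearMap.adjoint_inner_left,
      ← ContinuousLinearMap.star_eq_adjoint, h2, inner_self_eq_norm_sq_to_K]
    norm_cast
  rw [h3, mul_comm]
  exact (Complex.re_le_norm _).trans (norm_inner_le_norm _ _)

theorem compact_of_sq {S : H →L[ℂ] H} (hS : IsSelfAdjoint S) (h : IsCompactOperator ⇑(S * S)) :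
    IsCompactOperator S := by
  refine compact_of_bound h fun x => ?_
  have h2 : star S = S := hS
  have h3 : ‖S x‖ ^ 2 = (⟪x, (S * S) x⟫_ℂ).re := by
    rw [mul_apply_eq_comp, ← ContinuousLinearMap.adjoint_inner_left,
      ← ContinuousLinearMap.star_eq_adjoint, h2, inner_self_eq_norm_sq_to_K]
    norm_cast
  rw [h3, mul_comm]
  exact (Complex.re_le_norm _).trans (norm_inner_le_norm _ _)

theorem compact_of_pow {S : H →L[ℂ] H} (hS : IsSelfAdjoint S) (k : ℕ)
    (h : IsCompactOperator ⇑(S ^ (2 ^ k))) : IsCompactOperator S := by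
  induction k with
  | zero => simpa using h
  | succ k ih =>
    refine ih (compact_of_sq (hS.pow _) ?_)
    rwa [← pow_add, ← two_mul, ← pow_succ']

theorem compact_of_abs {A : H →L[ℂ] H} (h : IsCompactOperator ⇑(CFC.abs A)) :
    IsCompactOperator A := by
  have : IsCompactOperator ⇑(star A * A) := by
    rw [← CFC.abs_mul_abs]
    exact h.comp_clm _
  refine compact_of_bound this fun x => ?_
  have h3 : ‖A x‖ ^ 2 = (⟪x, (star A * A) x⟫_ℂ).re := by
    rw [mul_apply_eq_comp, ContinuousLinearMap.star_eq_adjoint,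
      ContinuousLinearMap.adjoint_inner_right, inner_self_eq_norm_sq_to_K]
    norm_cast
  rw [h3, mul_comm]
  exact (Complex.re_le_norm _).trans (norm_inner_le_norm _ _)

theorem rpow_split {S : H →L[ℂ] H} (hS : 0 ≤ S) (n : ℕ) {p : ℝ} (hp : 0 ≤ p) (hn : p ≤ n) :
    S ^ n = S ^ p * S ^ ((n : ℝ) - p) := by
  rw [← CFC.rpow_natCast S n hS, CFC.rpow_def, CFC.rpow_def, CFC.rpow_def,
    ← cfc_mul _ _ S (NNReal.continuous_rpow_const hp).continuousOn
      (NNReal.continuous_rpow_const (sub_nonneg.mpr hn)).continuousOn]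
  refine cfc_congr fun x _ => ?_
  rw [← NNReal.rpow_add_of_nonneg _ hp (sub_nonneg.mpr hn), add_sub_cancel]

theorem compact_of_rpow {S : H →L[ℂ] H} (hS : 0 ≤ S) {p : ℝ} (hp : 0 ≤ p)
    (h : IsCompactOperator ⇑(S ^ p)) : IsCompactOperator S := by
  obtain ⟨k, hk⟩ := pow_unbounded_of_one_lt p (one_lt_two)
  refine compact_of_pow hS.isSelfAdjoint k ?_
  rw [rpow_split hS (2 ^ k) hp (by exact_mod_cast hk.le)]
  exact h.comp_clm _

theorem compact_of_schatten {p : ℝ} (hp : 0 ≤ p) {A : H →L[ℂ] H}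
    (h : posTrace (CFC.abs A ^ p) ≠ ⊤) : IsCompactOperator A :=
  compact_of_abs (compact_of_rpow (CFC.abs_nonneg A) hp
    (compact_of_posTrace CFC.rpow_nonneg h))

theorem exists_svd {A : H →L[ℂ] H} (hc : IsCompactOperator A) :
    ∃ (ι : Type u) (b : HilbertBasis ι ℂ H) (μ : ι → ℝ), (∀ i, 0 ≤ μ i) ∧
      (∀ i j, ⟪A (b i), A (b j)⟫_ℂ = (μ i * μ j : ℂ) * ⟪b i, b j⟫_ℂ) ∧
      ∀ p : ℝ, 0 ≤ p → posTrace (CFC.abs A ^ p) = ∑' i, ENNReal.ofReal (μ i ^ p) := by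
  obtain ⟨ι, b, μ, h⟩ := exists_eigenbasis (CFC.abs_nonneg A) (compact_abs hc)
  refine ⟨ι, b, μ, fun i => (h i).1, fun i j => ?_, fun p hp => ?_⟩
  · have h2 : star (CFC.abs A) = CFC.abs A := (CFC.abs_nonneg A).isSelfAdjoint
    have h3 : ⟪A (b i), A (b j)⟫_ℂ = ⟪CFC.abs A (b i), CFC.abs A (b j)⟫_ℂ := by
      conv_rhs => rw [← ContinuousLinearMap.adjoint_inner_right,
        ← ContinuousLinearMap.star_eq_adjoint, h2, ← mul_apply_eq_comp, CFC.abs_mul_abs,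
        mul_apply_eq_comp, ContinuousLinearMap.star_eq_adjoint,
        ContinuousLinearMap.adjoint_inner_right]
    rw [h3, (h i).2, (h j).2, inner_smul_left, inner_smul_right, Complex.conj_ofReal, mul_assoc]
  · rw [posTrace_eq b CFC.rpow_nonneg]
    congr! 2 with i
    have hn : ‖b i‖ = 1 := b.orthonormal.1 i
    rw [rpow_eigen (CFC.abs_nonneg A) (by rw [← norm_ne_zero_iff, hn]; simp) (h i).2 hp,
      inner_smul_right, inner_self_eq_norm_sq_to_K, hn]
    simp

theorem exists_svd' {A : H →L[ℂ] H} (hc : IsCompactOperator A) :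
    ∃ (ι : Type u) (e f : ι → H) (μ : ι → ℝ), Orthonormal ℂ e ∧ Orthonormal ℂ f ∧
      (∀ i, 0 < μ i) ∧ (∀ x, HasSum (fun i => (⟪e i, x⟫_ℂ * μ i) • f i) (A x)) ∧
      ∀ p : ℝ, 0 < p → posTrace (CFC.abs A ^ p) = ∑' i, ENNReal.ofReal (μ i) ^ p := by
  classical
  obtain ⟨ι, b, μ, h0, hin, htr⟩ := exists_svd hc
  have hz : ∀ i, μ i = 0 → A (b i) = 0 := fun i hi => by
    rw [← inner_self_eq_zero (𝕜 := ℂ), hin, hi]; simp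
  refine ⟨{i // μ i ≠ 0}, fun i => b i, fun i => ((μ i : ℂ)⁻¹) • A (b i), fun i => μ i,
    b.orthonormal.comp _ Subtype.val_injective, ?_, fun i => lt_of_le_of_ne (h0 i) i.2.symm,
    fun x => ?_, fun p hp => ?_⟩
  · rw [orthonormal_iff_ite]
    rintro ⟨i, hi⟩ ⟨j, hj⟩
    have hi' : (μ i : ℂ) ≠ 0 := by exact_mod_cast hi
    have hj' : (μ j : ℂ) ≠ 0 := by exact_mod_cast hj
    rw [inner_smul_left, inner_smul_right, hin, map_inv₀, Complex.conj_ofReal]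
    have := orthonormal_iff_ite.mp b.orthonormal i j
    simp only [this, Subtype.mk.injEq]
    split_ifs with h
    · subst h; field_simp
    · simp
  · have h1 := (b.hasSum_repr x).mapL A
    have h2 := (hasSum_subtype_iff_of_support_subset (s := {i | μ i ≠ 0}) (fun i hi => ?_)).mpr h1
    · refine Eq.mp ?_ h2
      congr 1
      funext ⟨i, hi⟩
      have hi' : (μ i : ℂ) ≠ 0 := by exact_mod_cast hi
      simp only [Function.comp, map_smul, smul_smul, b.repr_apply_apply]
      rw [mul_assoc, mul_inv_cancel₀ hi', mul_one]
    · intro h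
      apply hi
      simp [hz i h]
  · rw [htr p hp.le]
    have h1 := tsum_subtype {i | μ i ≠ 0} (fun i => ENNReal.ofReal (μ i ^ p))
    have h2 : (∑' i, ENNReal.ofReal (μ i ^ p)) =
        ∑' i : {i // μ i ≠ 0}, ENNReal.ofReal (μ i ^ p) := by
      refine Eq.trans ?_ h1.symm
      refine tsum_congr fun i => ?_
      by_cases hi : μ i = 0 <;> simp [Set.indicator, hi, hp.ne']
    rw [h2]
    exact tsum_congr fun i => (ENNReal.ofReal_rpow_of_nonneg (h0 i) hp.le).symm

theorem exists_families {A : H →L[ℂ] H} (hc : IsCompactOperator A) {p : ℝ} (hp : 0 < p) :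
    ∃ (ι : Type u) (e f : ι → H), Orthonormal ℂ e ∧ Orthonormal ℂ f ∧
      posTrace (CFC.abs A ^ p) = ∑' i, ‖⟪f i, A (e i)⟫_ℂ‖ₑ ^ p := by
  classical
  obtain ⟨ι, e, f, μ, he, hf, h0, hs, htr⟩ := exists_svd' hc
  refine ⟨ι, e, f, he, hf, ?_⟩
  rw [htr p hp]
  refine tsum_congr fun i => ?_
  have h1 : A (e i) = (μ i : ℂ) • f i := by
    refine (hs (e i)).unique ?_
    convert hasSum_ite_eq i ((μ i : ℂ) • f i) using 2 with j
    rw [orthonormal_iff_ite.mp he j i]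
    split_ifs with h
    · subst h; simp
    · simp
  rw [h1, inner_smul_right, orthonormal_iff_ite.mp hf i i, if_pos rfl, mul_one, ← ofReal_norm,
    Complex.norm_real, Real.norm_of_nonneg (h0 i).le]

theorem sum_le_posTrace {A : H →L[ℂ] H} (hc : IsCompactOperator A) {p : ℝ} (hp : 1 ≤ p)
    {κ : Type*} {e' f' : κ → H} (he' : Orthonormal ℂ e') (hf' : Orthonormal ℂ f') :
    ∑' k, ‖⟪f' k, A (e' k)⟫_ℂ‖ₑ ^ p ≤ posTrace (CFC.abs A ^ p) := by
  have hp0 : 0 < p := by linarith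
  obtain ⟨ι, e, f, μ, he, hf, h0, hs, htr⟩ := exists_svd' hc
  rw [htr p hp0]
  let m : ι → ℝ≥0∞ := fun i => ENNReal.ofReal (μ i)
  let v : ι → κ → ℝ≥0∞ := fun i k => (‖⟪e i, e' k⟫_ℂ‖ₑ ^ 2 + ‖⟪f i, f' k⟫_ℂ‖ₑ ^ 2) / 2
  have one : ∀ (g : κ → H), Orthonormal ℂ g → ∀ k, ‖g k‖ₑ ^ 2 = 1 := fun g hg k => by
    rw [← ofReal_norm, hg.1 k]; simp
  have one' : ∀ (g : ι → H), Orthonormal ℂ g → ∀ k, ‖g k‖ₑ ^ 2 = 1 := fun g hg k => by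
    rw [← ofReal_norm, hg.1 k]; simp
  have hsymm : ∀ x y : H, ‖⟪x, y⟫_ℂ‖ₑ = ‖⟪y, x⟫_ℂ‖ₑ := fun x y => by
    rw [← ofReal_norm, ← ofReal_norm, norm_inner_symm]
  have half : ∀ a b : ℝ≥0∞, a ≤ 1 → b ≤ 1 → (a + b) / 2 ≤ 1 := fun a b ha hb => by
    refine ENNReal.div_le_of_le_mul ?_
    rw [one_mul, ← one_add_one_eq_two]
    exact add_le_add ha hb
  have hrow : ∀ k, ∑' i, v i k ≤ 1 := fun k => by
    simp only [v, div_eq_mul_inv]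
    rw [ENNReal.tsum_mul_right, ENNReal.tsum_add, ← div_eq_mul_inv]
    exact half _ _ ((bessel he _).trans (one e' he' k).le) ((bessel hf _).trans (one f' hf' k).le)
  have hcol : ∀ i, ∑' k, v i k ≤ 1 := fun i => by
    simp only [v, div_eq_mul_inv, hsymm (e i), hsymm (f i)]
    rw [ENNReal.tsum_mul_right, ENNReal.tsum_add, ← div_eq_mul_inv]
    exact half _ _ ((bessel he' _).trans (one' e he i).le) ((bessel hf' _).trans (one' f hf i).le)
  have hbd : ∀ k, ‖⟪f' k, A (e' k)⟫_ℂ‖ₑ ≤ ∑' i, v i k * m i := fun k => by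
    have h1 := (hs (e' k)).mapL (innerSL ℂ (f' k))
    rw [innerSL_apply_apply] at h1
    rw [← h1.tsum_eq]
    refine enorm_tsum_le_tsum_enorm.trans (ENNReal.tsum_le_tsum fun i => ?_)
    rw [innerSL_apply_apply, inner_smul_right, enorm_mul, enorm_mul, hsymm (f' k) (f i), mul_right_comm]
    have h2 : ‖(μ i : ℂ)‖ₑ = m i := by
      rw [← ofReal_norm, Complex.norm_real, Real.norm_of_nonneg (h0 i).le]
    rw [h2]
    gcongr
    rw [ENNReal.le_div_iff_mul_le (by simp) (by simp), mul_comm, ← mul_assoc]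
    have h3 := two_mul_le_add_sq ‖⟪e i, e' k⟫_ℂ‖₊ ‖⟪f i, f' k⟫_ℂ‖₊
    simp only [enorm]
    exact_mod_cast h3
  have hpow : ∀ k, ‖⟪f' k, A (e' k)⟫_ℂ‖ₑ ^ p ≤ ∑' i, v i k * m i ^ p := fun k => by
    rw [← ENNReal.le_rpow_inv_iff hp0]
    refine (hbd k).trans ?_
    rw [ENNReal.tsum_eq_iSup_sum]
    refine iSup_le fun s => (ENNReal.inner_le_weight_mul_Lp_of_nonneg s hp _ _).trans ?_
    calc _ ≤ (1 : ℝ≥0∞) ^ (1 - p⁻¹) * (∑' i, v i k * m i ^ p) ^ p⁻¹ := by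
          have : 0 ≤ 1 - p⁻¹ := sub_nonneg.mpr (inv_le_one_of_one_le₀ hp)
          gcongr
          · exact (ENNReal.sum_le_tsum s).trans (hrow k)
          · exact ENNReal.sum_le_tsum s
      _ = _ := by simp
  calc _ ≤ ∑' k, ∑' i, v i k * m i ^ p := ENNReal.tsum_le_tsum hpow
    _ = ∑' i, (∑' k, v i k) * m i ^ p := by
      rw [ENNReal.tsum_comm]; simp_rw [ENNReal.tsum_mul_right]
    _ ≤ ∑' i, m i ^ p := ENNReal.tsum_le_tsum fun i => by
      calc _ ≤ 1 * m i ^ p := by gcongr; exact hcol i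
        _ = _ := one_mul _

/-- `(tr |A|^p)^(1/p)` as an element of `[0, ∞]`. -/
noncomputable def eSchattenNorm (p : ℝ) (A : H →L[ℂ] H) : ℝ≥0∞ :=
  posTrace (CFC.abs A ^ p) ^ (1 / p)

theorem eSchattenNorm_add_le {p : ℝ} (hp : 1 ≤ p) (A B : H →L[ℂ] H) :
    eSchattenNorm p (A + B) ≤ eSchattenNorm p A + eSchattenNorm p B := by
  have hp0 : 0 < p := by linarith
  by_cases hA : posTrace (CFC.abs A ^ p) = ⊤
  · simp [eSchattenNorm, hA, hp0]
  by_cases hB : posTrace (CFC.abs B ^ p) = ⊤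
  · simp [eSchattenNorm, hB, hp0]
  have cA := compact_of_schatten hp0.le hA
  have cB := compact_of_schatten hp0.le hB
  obtain ⟨ι, e, f, he, hf, htr⟩ := exists_families (A := A + B) (cA.add cB) hp0
  rw [eSchattenNorm, htr, one_div, ENNReal.rpow_inv_le_iff hp0, ENNReal.tsum_eq_iSup_sum]
  refine iSup_le fun s => ?_
  rw [← ENNReal.rpow_inv_le_iff hp0, ← one_div]
  calc (∑ i ∈ s, ‖⟪f i, (A + B) (e i)⟫_ℂ‖ₑ ^ p) ^ (1 / p)
      ≤ (∑ i ∈ s, (‖⟪f i, A (e i)⟫_ℂ‖ₑ + ‖⟪f i, B (e i)⟫_ℂ‖ₑ) ^ p) ^ (1 / p) := by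
        gcongr with i
        rw [add_apply, inner_add_right]
        exact enorm_add_le _ _
    _ ≤ _ := ENNReal.Lp_add_le s _ _ hp
    _ ≤ _ := by
        unfold eSchattenNorm
        gcongr
        · exact (ENNReal.sum_le_tsum s).trans (sum_le_posTrace cA hp he hf)
        · exact (ENNReal.sum_le_tsum s).trans (sum_le_posTrace cB hp he hf)

theorem eSchattenNorm_zero {p : ℝ} (hp : 0 < p) : eSchattenNorm p (0 : H →L[ℂ] H) = 0 := by
  obtain ⟨ι, e, f, he, hf, htr⟩ := exists_families (A := (0 : H →L[ℂ] H)) isCompactOperator_zero hp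
  rw [eSchattenNorm, htr]
  simp [hp]

theorem eSchattenNorm_smul_le {p : ℝ} (hp : 1 ≤ p) (c : ℂ) {A : H →L[ℂ] H}
    (hA : eSchattenNorm p A ≠ ⊤) : eSchattenNorm p (c • A) ≤ ‖c‖ₑ * eSchattenNorm p A := by
  have hp0 : 0 < p := by linarith
  have hA' : posTrace (CFC.abs A ^ p) ≠ ⊤ := by
    rintro h
    simp [eSchattenNorm, h, hp0] at hA
  have cA := compact_of_schatten hp0.le hA'
  obtain ⟨ι, e, f, he, hf, htr⟩ := exists_families (A := c • A) (cA.smul c) hp0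
  rw [eSchattenNorm, eSchattenNorm, htr, one_div, ENNReal.rpow_inv_le_iff hp0,
    ENNReal.mul_rpow_of_nonneg _ _ hp0.le, ENNReal.rpow_inv_rpow hp0.ne']
  refine le_trans ?_ (mul_le_mul_right (sum_le_posTrace cA hp he hf) _)
  rw [← ENNReal.tsum_mul_left]
  refine ENNReal.tsum_le_tsum fun i => ?_
  rw [smul_apply, inner_smul_right, enorm_mul, ENNReal.mul_rpow_of_nonneg _ _ hp0.le]

theorem eSchattenNorm_lt_top_iff {p : ℝ} (hp : 0 < p) {A : H →L[ℂ] H} :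
    eSchattenNorm p A < ⊤ ↔ posTrace (CFC.abs A ^ p) < ⊤ := by
  unfold eSchattenNorm
  exact ENNReal.rpow_lt_top_iff_of_pos (by positivity)

theorem eq_zero_of_eSchattenNorm {p : ℝ} (hp : 0 < p) {A : H →L[ℂ] H}
    (h : eSchattenNorm p A = 0) : A = 0 := by
  have h0 : posTrace (CFC.abs A ^ p) = 0 := by
    simpa [eSchattenNorm, hp, hp.not_gt] using h
  obtain ⟨ι, e, f, μ, he, hf, hμ, hs, htr⟩ :=
    exists_svd' (compact_of_schatten hp.le (by rw [h0]; exact ENNReal.zero_ne_top))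
  rw [htr p hp, ENNReal.tsum_eq_zero] at h0
  have : IsEmpty ι := ⟨fun i => by simpa [hp, hp.not_gt, (hμ i).not_ge] using h0 i⟩
  ext x
  exact (hs x).unique hasSum_empty

section
variable (p : ℝ) [Fact (1 ≤ p)] (H)

/-- The operators `A` such that `|A|^p` is trace class form a linear subspace of `B(H)`. -/
def schattenSubmodule : Submodule ℂ (H →L[ℂ] H) where
  carrier := {A | posTrace (CFC.abs A ^ p) < ⊤}
  zero_mem' := by
    have hp : 0 < p := lt_of_lt_of_le one_pos Fact.out
    rw [Set.mem_ofPred_eq, ← eSchattenNorm_lt_top_iff hp, eSchattenNorm_zero hp]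
    exact ENNReal.zero_lt_top
  add_mem' := by
    intro A B hA hB
    have hp : 0 < p := lt_of_lt_of_le one_pos Fact.out
    rw [Set.mem_ofPred_eq, ← eSchattenNorm_lt_top_iff hp] at *
    exact (eSchattenNorm_add_le Fact.out A B).trans_lt (ENNReal.add_lt_top.mpr ⟨hA, hB⟩)
  smul_mem' := by
    intro c A hA
    have hp : 0 < p := lt_of_lt_of_le one_pos Fact.out
    rw [Set.mem_ofPred_eq, ← eSchattenNorm_lt_top_iff hp] at *
    exact (eSchattenNorm_smul_le Fact.out c hA.ne).trans_lt (ENNReal.mul_lt_top enorm_lt_top hA)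

end
end Schatten

/-- The Schatten class `𝒥_p(H)`: the bounded operators `A` on `H` such that `|A|^p` is trace class.
(A type of its own, because its norm is the Schatten norm and not the operator norm.) -/
def SchattenClass (p : ℝ) [Fact (1 ≤ p)] (H : Type*) [NormedAddCommGroup H]
    [InnerProductSpace ℂ H] [CompleteSpace H] : Type _ :=
  Schatten.schattenSubmodule H p

namespace SchattenClass

variable {p : ℝ} [Fact (1 ≤ p)] {H : Type*} [NormedAddCommGroup H] [InnerProductSpace ℂ H]
  [CompleteSpace H]

noncomputable instance : AddCommGroup (SchattenClass p H) :=
  inferInstanceAs (AddCommGroup (Schatten.schattenSubmodule H p))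

noncomputable instance : Module ℂ (SchattenClass p H) :=
  inferInstanceAs (Module ℂ (Schatten.schattenSubmodule H p))

/-- The inclusion of `𝒥_p` into the bounded operators. -/
def toOp : SchattenClass p H →ₗ[ℂ] (H →L[ℂ] H) := (Schatten.schattenSubmodule H p).subtype

theorem toOp_injective : Function.Injective (toOp : SchattenClass p H → (H →L[ℂ] H)) :=
  Subtype.val_injective

theorem eSchattenNorm_lt_top (A : SchattenClass p H) : Schatten.eSchattenNorm p (toOp A) < ⊤ :=
  (Schatten.eSchattenNorm_lt_top_iff (lt_of_lt_of_le one_pos Fact.out)).mpr A.2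

/-- `‖A‖_p = (tr |A|^p)^(1/p)`. -/
noncomputable def schattenNorm : AddGroupNorm (SchattenClass p H) where
  toFun A := (Schatten.eSchattenNorm p (toOp A)).toReal
  map_zero' := by
    rw [map_zero, Schatten.eSchattenNorm_zero (lt_of_lt_of_le one_pos Fact.out), ENNReal.toReal_zero]
  add_le' A B := by
    rw [← ENNReal.toReal_add (eSchattenNorm_lt_top A).ne (eSchattenNorm_lt_top B).ne, map_add]
    exact ENNReal.toReal_mono
      (ENNReal.add_ne_top.mpr ⟨(eSchattenNorm_lt_top A).ne, (eSchattenNorm_lt_top B).ne⟩)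
      (Schatten.eSchattenNorm_add_le Fact.out _ _)
  neg' A := by
    rw [map_neg, Schatten.eSchattenNorm, CFC.abs_neg, ← Schatten.eSchattenNorm]
  eq_zero_of_map_eq_zero' A h := by
    rcases (ENNReal.toReal_eq_zero_iff _).mp h with h | h
    · exact toOp_injective ((Schatten.eq_zero_of_eSchattenNorm
        (lt_of_lt_of_le one_pos Fact.out) h).trans (map_zero toOp).symm)
    · exact absurd h (eSchattenNorm_lt_top A).ne

noncomputable instance : NormedAddCommGroup (SchattenClass p H) :=
  (schattenNorm (p := p) (H := H)).toNormedAddCommGroup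

noncomputable instance : NormedSpace ℂ (SchattenClass p H) where
  norm_smul_le c A := by
    have h := Schatten.eSchattenNorm_smul_le (Fact.out : 1 ≤ p) c (eSchattenNorm_lt_top A).ne
    have h2 := ENNReal.toReal_mono
      (ENNReal.mul_ne_top enorm_ne_top (eSchattenNorm_lt_top A).ne) h
    rw [ENNReal.toReal_mul, toReal_enorm, ← map_smul] at h2
    exact h2

theorem norm_def (A : SchattenClass p H) :
    ‖A‖ = ((Schatten.posTrace (CFC.abs (toOp A) ^ p)) ^ (1 / p)).toReal := rfl

/-- The absolute value `|A| = (A⋆A)^(1/2)`, as an element of `𝒥_p`. -/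
noncomputable def abs (A : SchattenClass p H) : SchattenClass p H :=
  ⟨CFC.abs (toOp A), by
    change Schatten.posTrace (CFC.abs (CFC.abs (toOp A)) ^ p) < ⊤
    rw [CFC.cfcAbs_cfcAbs]
    exact A.2⟩

@[simp] theorem toOp_abs (A : SchattenClass p H) : toOp A.abs = CFC.abs (toOp A) := rfl

/-- An `n × n` matrix `A` with entries in `𝒥_p(H)` (that is, an element of `𝒥_p(H) ⊗ B(ℂⁿ)`), viewed
as a block operator on `H ⊗ ℂⁿ = H ⊕ ⋯ ⊕ H`, is nonnegative: `⟨x, A x⟩ ≥ 0` for all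
`x = (x 1, …, x n)`. (`0 ≤ z` for complex `z` means that `z` is real and nonnegative.) -/
def BlockNonneg {n : ℕ} (A : Matrix (Fin n) (Fin n) (SchattenClass p H)) : Prop :=
  ∀ x : Fin n → H, 0 ≤ ∑ i, ∑ j, ⟪x i, toOp (A i j) (x j)⟫_ℂ

/-- The linear map `φ` in `𝒥_p(H)` is `n`-positive: the induced map `φ ⊗ id` on
`𝒥_p(H) ⊗ B(ℂⁿ)`, which applies `φ` to each block, preserves nonnegativity. -/
def IsNPositive (n : ℕ) (φ : SchattenClass p H →ₗ[ℂ] SchattenClass p H) : Prop :=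
  ∀ A : Matrix (Fin n) (Fin n) (SchattenClass p H), BlockNonneg A → BlockNonneg (A.map φ)

/-- The operator norm `‖φ‖_p = sup {‖φ A‖_p : ‖A‖_p ≤ 1} ∈ [0, ∞]` of a linear map in `𝒥_p(H)`
(`∞` exactly when `φ` is not bounded). -/
noncomputable def opENorm (φ : SchattenClass p H →ₗ[ℂ] SchattenClass p H) : ℝ≥0∞ :=
  ⨆ (A : SchattenClass p H) (_ : ‖A‖ ≤ 1), ‖φ A‖ₑ

/-- The spectral radius `r_p(φ) = lim ‖φⁿ‖_p^(1/n)` of a linear map in `𝒥_p(H)`. The limit exists for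
every bounded `φ`, so that the upper limit is the limit. -/
noncomputable def specRadius (φ : SchattenClass p H →ₗ[ℂ] SchattenClass p H) : ℝ≥0∞ :=
  Filter.limsup (fun n : ℕ => opENorm (φ ^ n) ^ (1 / n : ℝ)) Filter.atTop

end SchattenClass

/-! The eigenvalue equation `φ(A) = l A` with `|l| = ‖φ‖` is an equality case of an inequality.

The block operator `(|A⋆|, A; A⋆, |A|)` is nonnegative (`abs_block_nonneg`), so 2-positivity makes
`(Q, l A; C, P)` nonnegative, where `P = φ(|A|)`, `Q = φ(|A⋆|)` and `C = φ(A⋆)`; moreover `P` and `Q`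
have `p`-norm at most `‖φ‖ ‖A‖_p = ‖l A‖_p`. Let `|A| b_i = μ_i b_i` for a Hilbert basis `b`, and for
`μ_i ≠ 0` let `g_i` be the unit vector opposite to `l A b_i`. Testing the block operator on
`(g_i, b_i)` gives `|l| μ_i ≤ (⟨g_i, Q g_i⟩ + ⟨b_i, P b_i⟩) / 2`. Taking `p`-th powers, using the
convexity of `t ↦ t ^ p` and summing over `i`, one finds `‖l A‖_p^p` on the left and at most
`‖l A‖_p^p` on the right, because the diagonal of an operator with respect to an orthonormal family
has `ℓ^p`-norm at most the Schatten norm. All the inequalities are therefore equalities, the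
quadratic form of the block operator vanishes at `(g_i, b_i)`, and hence this vector lies in the
kernel (`block_kernel`), which says `P b_i = |l| μ_i b_i`. These diagonal entries already exhaust
`‖P‖_p`, so that `P b_j = 0` when `μ_j = 0`. Altogether `P = |l| |A|` (`eq_smul_abs_of_block`). The
argument is the same for `p = 1` and `p > 1`.

For a compact `φ` with positive spectral radius, the Schatten class being complete, Gelfand's formula
and the Fredholm alternative provide an eigenvalue of modulus `r_p(φ)`, to which the above applies.
If `r_p(φ) = ‖φ‖_p = 0`, then `φ = 0`. -/

namespace Schatten

universe u

variable {H : Type u} [NormedAddCommGroup H] [InnerProductSpace ℂ H] [CompleteSpace H]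

/-! ### Adjoints and Schatten norms -/

theorem isCompactOperator_star {A : H →L[ℂ] H} (h : IsCompactOperator A) :
    IsCompactOperator ⇑(star A) := by
  have h1 : IsCompactOperator ⇑(A * star A) := h.comp_clm _
  refine compact_of_bound h1 fun x => ?_
  have h3 : ‖(star A) x‖ ^ 2 = (⟪x, (A * star A) x⟫_ℂ).re := by
    rw [mul_apply_eq_comp, ← ContinuousLinearMap.adjoint_inner_left,
      ← ContinuousLinearMap.star_eq_adjoint, inner_self_eq_norm_sq_to_K]
    norm_cast
  rw [h3, mul_comm]
  exact (Complex.re_le_norm _).trans (norm_inner_le_norm _ _)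

theorem eSchattenNorm_abs (p : ℝ) (A : H →L[ℂ] H) :
    eSchattenNorm p (CFC.abs A) = eSchattenNorm p A := by
  rw [eSchattenNorm, CFC.cfcAbs_cfcAbs, ← eSchattenNorm]

theorem posTrace_eq_eSchattenNorm_rpow {p : ℝ} (hp : 0 < p) (A : H →L[ℂ] H) :
    posTrace (CFC.abs A ^ p) = eSchattenNorm p A ^ p := by
  rw [eSchattenNorm, one_div, ENNReal.rpow_inv_rpow hp.ne']

theorem isCompactOperator_of_eSchattenNorm {p : ℝ} (hp : 0 < p) {A : H →L[ℂ] H}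
    (hA : eSchattenNorm p A < ⊤) : IsCompactOperator A :=
  compact_of_schatten hp.le ((eSchattenNorm_lt_top_iff hp).mp hA).ne

theorem eSchattenNorm_star_le {p : ℝ} (hp : 1 ≤ p) (A : H →L[ℂ] H) :
    eSchattenNorm p (star A) ≤ eSchattenNorm p A := by
  have hp0 : 0 < p := by linarith
  by_cases hA : eSchattenNorm p A = ⊤
  · simp [hA]
  have hc := isCompactOperator_of_eSchattenNorm hp0 (lt_top_iff_ne_top.mpr hA)
  obtain ⟨ι, e, f, he, hf, htr⟩ := exists_families (isCompactOperator_star hc) hp0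
  unfold eSchattenNorm
  gcongr
  rw [htr]
  refine le_trans (le_of_eq (tsum_congr fun i => ?_)) (sum_le_posTrace hc hp hf he)
  rw [ContinuousLinearMap.star_eq_adjoint, ContinuousLinearMap.adjoint_inner_right,
    ← inner_conj_symm, RCLike.enorm_conj]

/-! ### Nonnegative block operators -/

theorem clm_ext_hilbertBasis {ι : Type*} (b : HilbertBasis ι ℂ H) {S T : H →L[ℂ] H}
    (h : ∀ i, S (b i) = T (b i)) : S = T := by
  ext x
  have h1 := (b.hasSum_repr x).mapL S
  simp only [map_smul, h] at h1
  have h2 := (b.hasSum_repr x).mapL T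
  simp only [map_smul] at h2
  exact h1.unique h2

/-- `|A⋆| A = A |A|`: if `|A| b = μ b`, then `A b` is an eigenvector of `A A⋆` for `μ²`, and so of its
square root `|A⋆|` for `μ`. -/
theorem abs_star_mul_self {A : H →L[ℂ] H} (hc : IsCompactOperator A) :
    CFC.abs (star A) * A = A * CFC.abs A := by
  obtain ⟨ι, b, μ, h⟩ := exists_eigenbasis (CFC.abs_nonneg A) (compact_abs hc)
  refine clm_ext_hilbertBasis b fun i => ?_
  rw [mul_apply_eq_comp, mul_apply_eq_comp, (h i).2, map_smul]
  by_cases h0 : A (b i) = 0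
  · simp [h0]
  have h1 : (star (star A) * star A) (A (b i)) = ((μ i ^ 2 : ℝ) : ℂ) • A (b i) := by
    have h2 : (star A * A) (b i) = ((μ i ^ 2 : ℝ) : ℂ) • b i := by
      rw [← CFC.abs_mul_abs, mul_apply_eq_comp, (h i).2, map_smul, (h i).2, smul_smul]
      push_cast
      rw [sq]
    rw [star_star, mul_apply_eq_comp, ← mul_apply_eq_comp (star A) A, h2, map_smul]
  have hnn : 0 ≤ star (star A) * star A := star_mul_self_nonneg _
  have h3 := rpow_eigen hnn h0 h1 (p := 1 / 2) (by norm_num)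
  rw [CFC.abs, CFC.sqrt_eq_rpow, h3, ← Real.sqrt_eq_rpow, Real.sqrt_sq (h i).1]

theorem inner_apply_self_nonneg {T : H →L[ℂ] H} (hT : 0 ≤ T) (x : H) : 0 ≤ ⟪x, T x⟫_ℂ :=
  ((ContinuousLinearMap.nonneg_iff_isPositive T).mp hT).inner_nonneg_right x

/-- The block operator `(|A⋆|, A; A⋆, |A|)` is nonnegative. For `y = |A| u`, its quadratic form at
`(x, y)` equals `⟨x + A u, |A⋆| (x + A u)⟩`, by `abs_star_mul_self`; for `y` in the kernel of `|A|`
(which is that of `A`) only the term with `|A⋆|` remains. The sum of the range and the kernel of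
`|A|` is dense. -/
theorem abs_block_nonneg {A : H →L[ℂ] H} (hc : IsCompactOperator A) (x y : H) :
    0 ≤ ⟪x, CFC.abs (star A) x⟫_ℂ + ⟪x, A y⟫_ℂ + (⟪y, star A x⟫_ℂ + ⟪y, CFC.abs A y⟫_ℂ) := by
  obtain ⟨ι, b, μ, h⟩ := exists_eigenbasis (CFC.abs_nonneg A) (compact_abs hc)
  have hsa : ∀ u v : H, ⟪CFC.abs A u, v⟫_ℂ = ⟪u, CFC.abs A v⟫_ℂ :=
    (CFC.abs_nonneg A).isSelfAdjoint.isSymmetric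
  have hsa' : ∀ u v : H, ⟪CFC.abs (star A) u, v⟫_ℂ = ⟪u, CFC.abs (star A) v⟫_ℂ :=
    (CFC.abs_nonneg (star A)).isSelfAdjoint.isSymmetric
  have hAA : ∀ u, CFC.abs (star A) (A u) = A (CFC.abs A u) := fun u => by
    rw [← mul_apply_eq_comp, abs_star_mul_self hc, mul_apply_eq_comp]
  set V : Submodule ℂ H := LinearMap.range (CFC.abs A).toLinearMap ⊔
    LinearMap.ker (CFC.abs A).toLinearMap with hV
  have hdense : V.topologicalClosure = ⊤ := by
    rw [eq_top_iff, ← b.dense_span]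
    refine Submodule.topologicalClosure_mono ?_
    rw [Submodule.span_le]
    rintro _ ⟨i, rfl⟩
    by_cases hi : μ i = 0
    · refine Submodule.mem_sup_right ?_
      have := (h i).2
      rw [hi] at this
      simpa using this
    · refine Submodule.mem_sup_left ⟨((μ i : ℂ)⁻¹) • b i, ?_⟩
      have hi' : (μ i : ℂ) ≠ 0 := by exact_mod_cast hi
      change CFC.abs A _ = _
      rw [map_smul, (h i).2, smul_smul, inv_mul_cancel₀ hi', one_smul]
  have hclosed : IsClosed {y : H | 0 ≤ ⟪x, CFC.abs (star A) x⟫_ℂ + ⟪x, A y⟫_ℂ +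
      (⟪y, star A x⟫_ℂ + ⟪y, CFC.abs A y⟫_ℂ)} := by
    refine isClosed_le continuous_const ?_
    fun_prop
  have hsub : (V : Set H) ⊆ {y : H | 0 ≤ ⟪x, CFC.abs (star A) x⟫_ℂ + ⟪x, A y⟫_ℂ +
      (⟪y, star A x⟫_ℂ + ⟪y, CFC.abs A y⟫_ℂ)} := by
    intro y hy
    obtain ⟨_, ⟨u, rfl⟩, v, hv, rfl⟩ := Submodule.mem_sup.mp hy
    have hv0 : CFC.abs A v = 0 := hv
    have hAv : A v = 0 := by rw [← norm_eq_zero, ← norm_abs_apply, hv0, norm_zero]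
    have h1 := inner_apply_self_nonneg (CFC.abs_nonneg (star A)) (x + A u)
    have h2 : ⟪A u, A (CFC.abs A u)⟫_ℂ = ⟪CFC.abs A u, CFC.abs A (CFC.abs A u)⟫_ℂ := by
      rw [hsa, ← mul_apply_eq_comp (CFC.abs A) (CFC.abs A), CFC.abs_mul_abs, mul_apply_eq_comp,
        ContinuousLinearMap.star_eq_adjoint, ContinuousLinearMap.adjoint_inner_right]
    have h3 : ⟪A u, CFC.abs (star A) x⟫_ℂ = ⟪CFC.abs A u, star A x⟫_ℂ := by
      rw [← hsa', hAA, ContinuousLinearMap.star_eq_adjoint,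
        ContinuousLinearMap.adjoint_inner_right]
    have h4 : ⟪v, star A x⟫_ℂ = 0 := by
      rw [ContinuousLinearMap.star_eq_adjoint, ContinuousLinearMap.adjoint_inner_right, hAv,
        inner_zero_left]
    have h5 : ⟪v, CFC.abs A (CFC.abs A u)⟫_ℂ = 0 := by rw [← hsa, hv0, inner_zero_left]
    rw [map_add, hAA, inner_add_left, inner_add_right, inner_add_right, h2, h3] at h1
    change 0 ≤ _ + ⟪x, A (CFC.abs A u + v)⟫_ℂ + (⟪CFC.abs A u + v, _⟫_ℂ +
      ⟪CFC.abs A u + v, CFC.abs A (CFC.abs A u + v)⟫_ℂ)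
    rw [map_add, hAv, add_zero, map_add, hv0, add_zero, inner_add_left, inner_add_left, h4, h5,
      add_zero, add_zero]
    exact h1
  have : y ∈ V.topologicalClosure := by rw [hdense]; trivial
  exact closure_minimal hsub hclosed this

/-- A nonnegative block operator `(Q, B; C, P)` is self-adjoint, so that `C = B⋆`. -/
theorem block_eq_star {B C P Q : H →L[ℂ] H}
    (hblock : ∀ x y, 0 ≤ ⟪x, Q x⟫_ℂ + ⟪x, B y⟫_ℂ + (⟪y, C x⟫_ℂ + ⟪y, P y⟫_ℂ)) : C = star B := by
  have hQ : ∀ x, 0 ≤ ⟪x, Q x⟫_ℂ := fun x => by simpa using hblock x 0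
  have hP : ∀ x, 0 ≤ ⟪x, P x⟫_ℂ := fun x => by simpa using hblock 0 x
  -- The sum of the off-diagonal terms is real; for `I • y` instead of `y` this compares real parts.
  have him : ∀ x y, (⟪x, B y⟫_ℂ).im + (⟪y, C x⟫_ℂ).im = 0 := fun x y => by
    have h1 := (Complex.le_def.mp (hblock x y)).2
    have h2 := (Complex.le_def.mp (hQ x)).2
    have h3 := (Complex.le_def.mp (hP y)).2
    simp only [Complex.add_im, Complex.zero_im] at h1 h2 h3
    linarith
  have hre : ∀ x y, (⟪x, B y⟫_ℂ).re = (⟪y, C x⟫_ℂ).re := fun x y => by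
    have := him x (Complex.I • y)
    rw [map_smul, inner_smul_left, inner_smul_right] at this
    simp at this
    linarith
  ext x
  refine ext_inner_left ℂ fun y => ?_
  rw [ContinuousLinearMap.star_eq_adjoint, ContinuousLinearMap.adjoint_inner_right,
    ← inner_conj_symm (B y) x]
  refine Complex.ext ?_ ?_
  · rw [Complex.conj_re, hre]
  · rw [Complex.conj_im]
    linarith [him x y]

theorem block_nonneg_right {B C P Q : H →L[ℂ] H}
    (hblock : ∀ x y, 0 ≤ ⟪x, Q x⟫_ℂ + ⟪x, B y⟫_ℂ + (⟪y, C x⟫_ℂ + ⟪y, P y⟫_ℂ)) : 0 ≤ P := by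
  rw [ContinuousLinearMap.nonneg_iff_isPositive, ContinuousLinearMap.isPositive_iff_complex]
  intro z
  have h1 : 0 ≤ ⟪z, P z⟫_ℂ := by simpa using hblock 0 z
  have h2 : ⟪P z, z⟫_ℂ = ⟪z, P z⟫_ℂ := by
    rw [← inner_conj_symm]
    exact Complex.conj_eq_iff_im.mpr (Complex.le_def.mp h1).2.symm
  rw [h2]
  exact ⟨Complex.ext rfl (by simpa using (Complex.le_def.mp h1).2), (Complex.le_def.mp h1).1⟩

/-- A nonnegative block operator `(Q, B; C, P)` annihilates every vector `(x, y)` on which its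
quadratic form vanishes; this is the second component of that equation. -/
theorem block_kernel {B C P Q : H →L[ℂ] H}
    (hblock : ∀ x y, 0 ≤ ⟪x, Q x⟫_ℂ + ⟪x, B y⟫_ℂ + (⟪y, C x⟫_ℂ + ⟪y, P y⟫_ℂ)) {x y : H}
    (h0 : ⟪x, Q x⟫_ℂ + ⟪x, B y⟫_ℂ + (⟪y, C x⟫_ℂ + ⟪y, P y⟫_ℂ) = 0) : C x + P y = 0 := by
  have hre : ∀ x y, (⟪x, B y⟫_ℂ).re = (⟪y, C x⟫_ℂ).re := fun x y => by
    rw [block_eq_star hblock, ContinuousLinearMap.star_eq_adjoint,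
      ContinuousLinearMap.adjoint_inner_right, ← inner_conj_symm, Complex.conj_re]
  have hPs : ∀ x y, (⟪x, P y⟫_ℂ).re = (⟪y, P x⟫_ℂ).re := by
    have hpos : P.IsPositive :=
      (ContinuousLinearMap.nonneg_iff_isPositive P).mp (block_nonneg_right hblock)
    intro x y
    have : ⟪x, P y⟫_ℂ = ⟪P x, y⟫_ℂ := (hpos.isSymmetric x y).symm
    rw [this, ← inner_conj_symm, Complex.conj_re]
  set z := C x + P y with hz
  -- The form is nonnegative at `(x, y - s z)`, and its term of order zero in `s` vanishes.
  have key : ∀ s : ℝ, 0 < s → 2 * ‖z‖ ^ 2 ≤ s * (⟪z, P z⟫_ℂ).re := by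
    intro s hs
    have h1 := (Complex.le_def.mp (hblock x (y - (s : ℂ) • z))).1
    have h2 := congrArg Complex.re h0
    have h3 : ‖z‖ ^ 2 = (⟪z, C x⟫_ℂ).re + (⟪z, P y⟫_ℂ).re := by
      rw [← Complex.add_re, ← inner_add_right, ← hz, inner_self_eq_norm_sq_to_K]
      norm_cast
    have h4 := hre x z
    have h5 := hPs y z
    simp only [map_sub, map_smul, inner_sub_left, inner_sub_right, inner_smul_left,
      inner_smul_right, Complex.add_re, Complex.sub_re, Complex.conj_ofReal,
      Complex.re_ofReal_mul, Complex.zero_re] at h1 h2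
    have h6 : s * (2 * ‖z‖ ^ 2) ≤ s * (s * (⟪z, P z⟫_ℂ).re) := by
      rw [h3]
      nlinarith
    exact le_of_mul_le_mul_left h6 hs
  have hlim : Filter.Tendsto (fun s : ℝ => s * (⟪z, P z⟫_ℂ).re) (nhdsWithin 0 (Set.Ioi 0))
      (nhds 0) := by
    have : Continuous fun s : ℝ => s * (⟪z, P z⟫_ℂ).re := by fun_prop
    simpa using (this.tendsto 0).mono_left nhdsWithin_le_nhds
  have h7 : 2 * ‖z‖ ^ 2 ≤ 0 := ge_of_tendsto hlim (Filter.eventually_of_mem self_mem_nhdsWithin key)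
  have h8 : ‖z‖ ^ 2 = 0 := le_antisymm (by linarith) (by positivity)
  simpa using h8

/-! ### The equality case -/

theorem posTrace_rpow_of_eigenbasis {T : H →L[ℂ] H} (hT : 0 ≤ T) {ι : Type*}
    (b : HilbertBasis ι ℂ H) {μ : ι → ℝ} (h : ∀ i, 0 ≤ μ i ∧ T (b i) = (μ i : ℂ) • b i) {p : ℝ}
    (hp : 0 ≤ p) : posTrace (T ^ p) = ∑' i, ENNReal.ofReal (μ i) ^ p := by
  rw [posTrace_eq b CFC.rpow_nonneg]
  refine tsum_congr fun i => ?_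
  have hn : ‖b i‖ = 1 := b.orthonormal.1 i
  rw [rpow_eigen hT (by rw [← norm_ne_zero_iff, hn]; simp) (h i).2 hp,
    inner_smul_right, inner_self_eq_norm_sq_to_K, hn, ENNReal.ofReal_rpow_of_nonneg (h i).1 hp]
  simp

theorem eq_of_tsum_le_tsum {ι : Type*} {f g : ι → ℝ≥0∞} (hf : ∑' i, f i ≠ ⊤)
    (hfg : ∀ i, f i ≤ g i) (h : ∑' i, g i ≤ ∑' i, f i) (i : ι) : f i = g i := by
  by_contra hne
  exact h.not_gt (ENNReal.tsum_lt_tsum hf hfg (lt_of_le_of_ne (hfg i) hne))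

/-- The equality case: if `(Q, l A; C, P) ≥ 0` and neither `P` nor `Q` has a larger `p`-norm than
`l A`, then `P = |l| |A|`. -/
theorem eq_smul_abs_of_block {p : ℝ} (hp : 1 ≤ p) {A C P Q : H →L[ℂ] H} {l : ℂ} (hl : l ≠ 0)
    (hblock : ∀ x y, 0 ≤ ⟪x, Q x⟫_ℂ + ⟪x, (l • A) y⟫_ℂ + (⟪y, C x⟫_ℂ + ⟪y, P y⟫_ℂ))
    (hA : eSchattenNorm p A < ⊤) (hP : eSchattenNorm p P ≤ ‖l‖ₑ * eSchattenNorm p A)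
    (hQ : eSchattenNorm p Q ≤ ‖l‖ₑ * eSchattenNorm p A) :
    P = (‖l‖ : ℂ) • CFC.abs A := by
  have hp0 : 0 < p := by linarith
  have hr : 0 < ‖l‖ := norm_pos_iff.mpr hl
  have hC : C = star (l • A) := block_eq_star hblock
  have hfin : ‖l‖ₑ * eSchattenNorm p A < ⊤ := ENNReal.mul_lt_top enorm_lt_top hA
  have hcP := isCompactOperator_of_eSchattenNorm hp0 (hP.trans_lt hfin)
  have hcQ := isCompactOperator_of_eSchattenNorm hp0 (hQ.trans_lt hfin)
  obtain ⟨ι, b, μ, h⟩ := exists_eigenbasis (CFC.abs_nonneg A)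
    (compact_abs (isCompactOperator_of_eSchattenNorm hp0 hA))
  have hb1 : ∀ i, ‖b i‖ = 1 := b.orthonormal.1
  have hS : ∑' i, ENNReal.ofReal (‖l‖ * μ i) ^ p = (‖l‖ₑ * eSchattenNorm p A) ^ p := by
    rw [ENNReal.mul_rpow_of_nonneg _ _ hp0.le, ← posTrace_eq_eSchattenNorm_rpow hp0,
      posTrace_rpow_of_eigenbasis (CFC.abs_nonneg A) b h hp0.le, ← ENNReal.tsum_mul_left]
    refine tsum_congr fun i => ?_
    rw [ENNReal.ofReal_mul hr.le, ENNReal.mul_rpow_of_nonneg _ _ hp0.le, ofReal_norm]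
  have hSI : ∑' i : {i // μ i ≠ 0}, ENNReal.ofReal (‖l‖ * μ i) ^ p =
      (‖l‖ₑ * eSchattenNorm p A) ^ p := by
    rw [← hS]
    refine tsum_subtype_eq_of_support_subset (s := {i | μ i ≠ 0})
      (f := fun i => ENNReal.ofReal (‖l‖ * μ i) ^ p) fun i hi h0 => hi ?_
    simp [h0, hp0]
  have hStop : (‖l‖ₑ * eSchattenNorm p A) ^ p ≠ ⊤ := ENNReal.rpow_ne_top_of_nonneg hp0.le hfin.ne
  have hAA : ∀ i j, ⟪A (b i), A (b j)⟫_ℂ = (μ i * μ j : ℂ) * ⟪b i, b j⟫_ℂ := fun i j => by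
    rw [← ContinuousLinearMap.adjoint_inner_right, ← ContinuousLinearMap.star_eq_adjoint,
      ← mul_apply_eq_comp, ← CFC.abs_mul_abs, mul_apply_eq_comp, (h j).2, map_smul, (h j).2,
      smul_smul, inner_smul_right, mul_comm (μ i : ℂ)]
    rcases eq_or_ne i j with rfl | hij
    · rfl
    · rw [b.orthonormal.2 hij, mul_zero, mul_zero]
  -- The left singular vectors of `l A`, with the sign that makes the off-diagonal terms negative.
  let g : {i // μ i ≠ 0} → H := fun i => (-(l / (‖l‖ * μ i))) • A (b i)
  have hμ' : ∀ i : {i // μ i ≠ 0}, (μ i : ℂ) ≠ 0 := fun i => by exact_mod_cast i.2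
  have hll : (starRingEnd ℂ) l * l = (‖l‖ : ℂ) ^ 2 := by
    rw [← Complex.normSq_eq_conj_mul_self, Complex.normSq_eq_norm_sq]
    norm_cast
  have hg : Orthonormal ℂ g := by
    classical
    rw [orthonormal_iff_ite]
    intro i j
    have hi := hμ' i
    have hj := hμ' j
    simp only [g]
    rw [inner_smul_left, inner_smul_right, hAA, orthonormal_iff_ite.mp b.orthonormal]
    simp only [Subtype.ext_iff]
    split_ifs with hij
    · rw [map_neg, map_div₀, map_mul, Complex.conj_ofReal, Complex.conj_ofReal]
      field_simp
      exact hll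
    · simp
  have hblg : ∀ i, ⟪g i, (l • A) (b i)⟫_ℂ = -(‖l‖ * μ i : ℝ) := fun i => by
    have hi := hμ' i
    simp only [g]
    rw [smul_apply, inner_smul_left, inner_smul_right, hAA, inner_self_eq_norm_sq_to_K, hb1,
      map_neg, map_div₀, map_mul, Complex.conj_ofReal, Complex.conj_ofReal]
    push_cast
    field_simp
    rw [hll]
  have hCg : ∀ i, C (g i) = -((‖l‖ * μ i : ℝ) : ℂ) • b i := fun i => by
    have hi := hμ' i
    simp only [g]
    rw [hC, star_smul, smul_apply, map_smul, ← mul_apply_eq_comp (star A) A, ← CFC.abs_mul_abs,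
      mul_apply_eq_comp, (h i).2, map_smul, (h i).2, smul_smul, smul_smul, smul_smul]
    congr 1
    push_cast
    field_simp
    rw [← hll]
    rfl
  have hbC : ∀ i : {i // μ i ≠ 0}, ⟪b i, C (g i)⟫_ℂ = -(‖l‖ * μ i : ℝ) := fun i => by
    rw [hCg, inner_smul_right, inner_self_eq_norm_sq_to_K, hb1]
    simp
  have hPr : ∀ x, 0 ≤ ⟪x, P x⟫_ℂ := fun x => by simpa using hblock 0 x
  have hQr : ∀ x, 0 ≤ ⟪x, Q x⟫_ℂ := fun x => by simpa using hblock x 0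
  have hreal : ∀ z : ℂ, 0 ≤ z → ‖z‖ₑ = ENNReal.ofReal z.re := fun z hz => by
    rw [← ofReal_norm, ← Complex.re_eq_norm.mpr hz]
  have htP : ∑' i, ‖⟪b i, P (b i)⟫_ℂ‖ₑ ^ p ≤ (‖l‖ₑ * eSchattenNorm p A) ^ p := by
    refine (sum_le_posTrace hcP hp b.orthonormal b.orthonormal).trans ?_
    rw [posTrace_eq_eSchattenNorm_rpow hp0]
    gcongr
  have htPI : ∑' i : {i // μ i ≠ 0}, ‖⟪b i, P (b i)⟫_ℂ‖ₑ ^ p ≤ (‖l‖ₑ * eSchattenNorm p A) ^ p :=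
    (ENNReal.tsum_comp_le_tsum_of_injective Subtype.val_injective
      (fun i => ‖⟪b i, P (b i)⟫_ℂ‖ₑ ^ p)).trans htP
  have htQ : ∑' i, ‖⟪g i, Q (g i)⟫_ℂ‖ₑ ^ p ≤ (‖l‖ₑ * eSchattenNorm p A) ^ p := by
    refine (sum_le_posTrace hcQ hp hg hg).trans ?_
    rw [posTrace_eq_eSchattenNorm_rpow hp0]
    gcongr
  have hmean : ∀ i : {i // μ i ≠ 0}, ENNReal.ofReal (‖l‖ * μ i) ≤
      1 / 2 * ‖⟪g i, Q (g i)⟫_ℂ‖ₑ + 1 / 2 * ‖⟪b i, P (b i)⟫_ℂ‖ₑ := fun i => by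
    have h1 := (Complex.le_def.mp (hblock (g i) (b i))).1
    have h2 := (Complex.le_def.mp (hQr (g i))).1
    have h3 := (Complex.le_def.mp (hPr (b i))).1
    rw [hblg, hbC] at h1
    simp only [Complex.add_re, Complex.neg_re, Complex.ofReal_re, Complex.zero_re] at h1 h2 h3
    rw [hreal _ (hQr _), hreal _ (hPr _), ← mul_add, ← ENNReal.ofReal_add h2 h3,
      show (1 / 2 : ℝ≥0∞) = ENNReal.ofReal (1 / 2) by
        rw [ENNReal.ofReal_div_of_pos two_pos]; simp,
      ← ENNReal.ofReal_mul (by norm_num)]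
    exact ENNReal.ofReal_le_ofReal (by linarith)
  have hjensen := fun i : {i // μ i ≠ 0} => ENNReal.rpow_arith_mean_le_arith_mean2_rpow (1 / 2)
    (1 / 2) ‖⟪g i, Q (g i)⟫_ℂ‖ₑ ‖⟪b i, P (b i)⟫_ℂ‖ₑ (ENNReal.add_halves 1) hp
  -- Summed over `i`, both sides of the chain `hmean`, `hjensen` are `‖l A‖_p ^ p`.
  have heq := eq_of_tsum_le_tsum (hSI.trans_ne hStop)
    (fun i => (ENNReal.rpow_le_rpow (hmean i) hp0.le).trans (hjensen i)) (by
      rw [ENNReal.tsum_add, ENNReal.tsum_mul_left, ENNReal.tsum_mul_left, hSI]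
      calc _ ≤ 1 / 2 * (‖l‖ₑ * eSchattenNorm p A) ^ p + 1 / 2 * (‖l‖ₑ * eSchattenNorm p A) ^ p := by
            gcongr
        _ = _ := by rw [← add_mul, ENNReal.add_halves, one_mul])
  have hPb : ∀ i : {i // μ i ≠ 0}, P (b i) = ((‖l‖ * μ i : ℝ) : ℂ) • b i := fun i => by
    have h1 : ENNReal.ofReal (‖l‖ * μ i) =
        1 / 2 * ‖⟪g i, Q (g i)⟫_ℂ‖ₑ + 1 / 2 * ‖⟪b i, P (b i)⟫_ℂ‖ₑ :=
      le_antisymm (hmean i)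
        ((ENNReal.rpow_le_rpow_iff hp0).mp ((hjensen i).trans (heq i).ge))
    have h2 := (Complex.le_def.mp (hQr (g i)))
    have h3 := (Complex.le_def.mp (hPr (b i)))
    rw [hreal _ (hQr _), hreal _ (hPr _), ← mul_add, ← ENNReal.ofReal_add h2.1 h3.1,
      show (1 / 2 : ℝ≥0∞) = ENNReal.ofReal (1 / 2) by
        rw [ENNReal.ofReal_div_of_pos two_pos]; simp,
      ← ENNReal.ofReal_mul (by norm_num)] at h1
    have h4 := (ENNReal.ofReal_eq_ofReal_iff (mul_nonneg hr.le (h i).1)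
      (mul_nonneg (by norm_num) (add_nonneg h2.1 h3.1))).mp h1
    have h5 := block_kernel hblock (x := g i) (y := b i) (by
      rw [hblg, hbC]
      refine Complex.ext ?_ ?_
      · simp only [Complex.add_re, Complex.neg_re, Complex.ofReal_re, Complex.zero_re]
        linarith
      · have h2' := h2.2
        have h3' := h3.2
        simp only [Complex.add_im, Complex.neg_im, Complex.ofReal_im, Complex.zero_im] at h2' h3' ⊢
        linarith)
    rw [hCg, neg_smul, neg_add_eq_zero] at h5
    exact h5.symm
  have hle : ∀ i, ENNReal.ofReal (‖l‖ * μ i) ^ p ≤ ‖⟪b i, P (b i)⟫_ℂ‖ₑ ^ p := fun i => by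
    by_cases hi : μ i = 0
    · simp [hi, hp0]
    · rw [hPb ⟨i, hi⟩, inner_smul_right, inner_self_eq_norm_sq_to_K, hb1, ← ofReal_norm]
      simp [Real.norm_of_nonneg (h i).1, ENNReal.ofReal_mul]
  -- The entries with `μ i ≠ 0` exhaust the bound on the diagonal of `P`, so the others vanish.
  have heq' := eq_of_tsum_le_tsum (hS.trans_ne hStop) hle (htP.trans hS.ge)
  refine clm_ext_hilbertBasis b fun i => ?_
  rw [smul_apply, (h i).2, smul_smul, ← Complex.ofReal_mul]
  by_cases hi : μ i = 0
  · have h1 := heq' i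
    rw [hi, mul_zero, ENNReal.ofReal_zero, ENNReal.zero_rpow_of_pos hp0, eq_comm,
      ENNReal.rpow_eq_zero_iff_of_pos hp0, enorm_eq_zero] at h1
    -- The quadratic form of `P ≥ 0` vanishes at `b i`.
    have h2 := block_kernel hblock (x := 0) (y := b i) (by simp [h1])
    rw [map_zero, zero_add] at h2
    simp [h2, hi]
  · exact hPb ⟨i, hi⟩

/-! ### Completeness and nontriviality of the Schatten class -/

theorem enorm_le_eSchattenNorm {p : ℝ} (hp : 1 ≤ p) (A : H →L[ℂ] H) :
    ‖A‖ₑ ≤ eSchattenNorm p A := by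
  have hp0 : 0 < p := by linarith
  by_cases hA : eSchattenNorm p A = ⊤
  · simp [hA]
  have hc := isCompactOperator_of_eSchattenNorm hp0 (lt_top_iff_ne_top.mpr hA)
  rw [← ofReal_norm]
  refine ENNReal.ofReal_le_of_le_toReal
    (A.opNorm_le_bound ENNReal.toReal_nonneg fun x => ?_)
  by_cases hAx : A x = 0
  · rw [hAx, norm_zero]; positivity
  have hx : x ≠ 0 := fun h => hAx (by rw [h, map_zero])
  have hunit : ∀ z : H, z ≠ 0 → Orthonormal ℂ fun _ : Unit => ((‖z‖ : ℂ)⁻¹) • z := fun z hz =>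
    ⟨fun _ => norm_smul_inv_norm hz, fun i j hij => absurd (Subsingleton.elim i j) hij⟩
  have h1 := sum_le_posTrace hc hp (hunit x hx) (hunit (A x) hAx)
  rw [tsum_fintype, Fintype.sum_unique, posTrace_eq_eSchattenNorm_rpow hp0,
    ENNReal.rpow_le_rpow_iff hp0, map_smul, inner_smul_left, inner_smul_right,
    inner_self_eq_norm_sq_to_K, ← ofReal_norm, ENNReal.ofReal_le_iff_le_toReal hA] at h1
  have hx' : ‖x‖ ≠ 0 := norm_ne_zero_iff.mpr hx
  have hAx' : ‖A x‖ ≠ 0 := norm_ne_zero_iff.mpr hAx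
  have h2 : ‖(starRingEnd ℂ) (‖A x‖ : ℂ)⁻¹ * ((‖x‖ : ℂ)⁻¹ * (‖A x‖ : ℂ) ^ 2)‖ = ‖A x‖ / ‖x‖ := by
    simp only [norm_mul, norm_inv, norm_pow, RCLike.norm_conj, Complex.norm_real, norm_norm]
    field_simp
  rw [← div_le_iff₀ (norm_pos_iff.mpr hx), ← h2]
  exact h1

/-- The Schatten norm is lower semicontinuous for the convergence in operator norm of compact
operators. -/
theorem eSchattenNorm_le_of_tendsto {p : ℝ} (hp : 1 ≤ p) {T : ℕ → H →L[ℂ] H} {A : H →L[ℂ] H}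
    (hT : Filter.Tendsto T Filter.atTop (nhds A)) {C : ℝ≥0∞} (hC : C ≠ ⊤)
    (h : ∀ᶠ n in Filter.atTop, eSchattenNorm p (T n) ≤ C) : eSchattenNorm p A ≤ C := by
  have hp0 : 0 < p := by linarith
  have hcn : ∀ᶠ n in Filter.atTop, IsCompactOperator (T n) := h.mono fun n hn =>
    isCompactOperator_of_eSchattenNorm hp0 (hn.trans_lt (lt_top_iff_ne_top.mpr hC))
  have hc : IsCompactOperator A := isClosed_setOfPred_isCompactOperator.mem_of_tendsto hT hcn
  obtain ⟨ι, e, f, he, hf, htr⟩ := exists_families hc hp0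
  rw [eSchattenNorm, htr, one_div, ENNReal.rpow_inv_le_iff hp0, ENNReal.tsum_eq_iSup_sum]
  refine iSup_le fun s => ?_
  have hlim : Filter.Tendsto (fun n => ∑ i ∈ s, ‖⟪f i, T n (e i)⟫_ℂ‖ₑ ^ p) Filter.atTop
      (nhds (∑ i ∈ s, ‖⟪f i, A (e i)⟫_ℂ‖ₑ ^ p)) := by
    refine tendsto_finsetSum s fun i _ => ?_
    have h1 : Continuous fun S : H →L[ℂ] H => ‖⟪f i, S (e i)⟫_ℂ‖ₑ ^ p := by
      refine (ENNReal.continuous_rpow_const (y := p)).comp (continuous_enorm.comp ?_)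
      fun_prop
    exact (h1.tendsto A).comp hT
  refine le_of_tendsto hlim ((h.and hcn).mono fun n hn => ?_)
  refine (ENNReal.sum_le_tsum s).trans ((sum_le_posTrace hn.2 hp he hf).trans ?_)
  rw [posTrace_eq_eSchattenNorm_rpow hp0]
  gcongr
  exact hn.1

theorem eSchattenNorm_rankOne_lt_top {p : ℝ} (hp : 1 ≤ p) {v : H} (hv : ‖v‖ = 1) :
    eSchattenNorm p ((innerSL ℂ v).smulRight v) < ⊤ := by
  have hp0 : 0 < p := by linarith
  have hc : IsCompactOperator ((innerSL ℂ v).smulRight v) :=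
    (isCompactOperator_of_locallyCompactSpace_rng
      (ContinuousLinearMap.toSpanSingleton ℂ v)).comp_clm (innerSL ℂ v)
  obtain ⟨ι, e, f, he, hf, htr⟩ := exists_families hc hp0
  have hv' : ‖v‖ₑ = 1 := by rw [← ofReal_norm, hv, ENNReal.ofReal_one]
  have hle : ∀ {g : ι → H}, Orthonormal ℂ g → ∀ i, ‖⟪g i, v⟫_ℂ‖ₑ ≤ 1 := fun {g} hg i => by
    rw [← ofReal_norm, ← ENNReal.ofReal_one]
    refine ENNReal.ofReal_le_ofReal ((norm_inner_le_norm _ _).trans ?_)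
    rw [hg.1, hv, one_mul]
  rw [eSchattenNorm_lt_top_iff hp0, htr]
  calc ∑' i, ‖⟪f i, ((innerSL ℂ v).smulRight v) (e i)⟫_ℂ‖ₑ ^ p
      ≤ ∑' i, (‖⟪e i, v⟫_ℂ‖ₑ ^ 2 + ‖⟪f i, v⟫_ℂ‖ₑ ^ 2) := ENNReal.tsum_le_tsum fun i => by
        rw [ContinuousLinearMap.smulRight_apply, innerSL_apply_apply, inner_smul_right, enorm_mul,
          ← inner_conj_symm v (e i), RCLike.enorm_conj]
        have h1 : ‖⟪e i, v⟫_ℂ‖ₑ * ‖⟪f i, v⟫_ℂ‖ₑ ≤ 1 := mul_le_one' (hle he i) (hle hf i)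
        refine (ENNReal.rpow_le_rpow_of_exponent_ge h1 hp).trans ?_
        rw [ENNReal.rpow_one]
        rcases le_total ‖⟪e i, v⟫_ℂ‖ₑ ‖⟪f i, v⟫_ℂ‖ₑ with h2 | h2
        · refine (mul_le_mul_left h2 _).trans ?_
          rw [← sq]; exact le_add_self
        · refine (mul_le_mul_right h2 _).trans ?_
          rw [← sq]; exact le_self_add
    _ = ∑' i, ‖⟪e i, v⟫_ℂ‖ₑ ^ 2 + ∑' i, ‖⟪f i, v⟫_ℂ‖ₑ ^ 2 := ENNReal.tsum_add
    _ ≤ ‖v‖ₑ ^ 2 + ‖v‖ₑ ^ 2 := add_le_add (bessel he v) (bessel hf v)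
    _ < ⊤ := by rw [hv']; simp

end Schatten

namespace SchattenClass

open Schatten

variable {p : ℝ} [Fact (1 ≤ p)] {H : Type*} [NormedAddCommGroup H] [InnerProductSpace ℂ H]
  [CompleteSpace H]

theorem enorm_eq_eSchattenNorm (A : SchattenClass p H) : ‖A‖ₑ = eSchattenNorm p (toOp A) := by
  rw [← ofReal_norm]
  exact ENNReal.ofReal_toReal (eSchattenNorm_lt_top A).ne

theorem exists_toOp_eq {T : H →L[ℂ] H} (hT : eSchattenNorm p T < ⊤) :
    ∃ A : SchattenClass p H, toOp A = T :=
  ⟨⟨T, (eSchattenNorm_lt_top_iff (lt_of_lt_of_le one_pos Fact.out)).mp hT⟩, rfl⟩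

/-- A Cauchy sequence converges in operator norm, and by lower semicontinuity of the Schatten norm
also in the Schatten class. -/
instance : CompleteSpace (SchattenClass p H) := by
  refine Metric.complete_of_cauchySeq_tendsto fun u hu => ?_
  have hp : 1 ≤ p := Fact.out
  have hnorm : ∀ A : SchattenClass p H, ‖toOp A‖ ≤ ‖A‖ := fun A => by
    have h := enorm_le_eSchattenNorm hp (toOp A)
    rwa [← enorm_eq_eSchattenNorm, enorm_le_iff_norm_le] at h
  have hu' : CauchySeq fun n => toOp (u n) := by
    rw [Metric.cauchySeq_iff] at hu ⊢
    intro ε hε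
    obtain ⟨N, hN⟩ := hu ε hε
    refine ⟨N, fun m hm n hn => lt_of_le_of_lt ?_ (hN m hm n hn)⟩
    rw [dist_eq_norm, dist_eq_norm, ← map_sub]
    exact hnorm _
  obtain ⟨T, hT⟩ := cauchySeq_tendsto_of_complete hu'
  have key : ∀ ε : ℝ, 0 < ε → ∃ N, ∀ n ≥ N,
      eSchattenNorm p (T - toOp (u n)) ≤ ENNReal.ofReal ε := fun ε hε => by
    obtain ⟨N, hN⟩ := Metric.cauchySeq_iff.mp hu ε hε
    refine ⟨N, fun n hn => eSchattenNorm_le_of_tendsto hp (hT.sub_const _) ENNReal.ofReal_ne_top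
      (Filter.eventually_atTop.mpr ⟨N, fun m hm => ?_⟩)⟩
    rw [← map_sub, ← enorm_eq_eSchattenNorm, ← ofReal_norm, ← dist_eq_norm]
    exact ENNReal.ofReal_le_ofReal (hN m hm n hn).le
  obtain ⟨A, hA⟩ : ∃ A : SchattenClass p H, toOp A = T := by
    obtain ⟨N, hN⟩ := key 1 one_pos
    obtain ⟨B, hB⟩ := exists_toOp_eq ((hN N le_rfl).trans_lt ENNReal.ofReal_lt_top)
    exact ⟨B + u N, by rw [map_add, hB, sub_add_cancel]⟩
  refine ⟨A, Metric.tendsto_atTop.mpr fun ε hε => ?_⟩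
  obtain ⟨N, hN⟩ := key (ε / 2) (by positivity)
  refine ⟨N, fun n hn => lt_of_le_of_lt ?_ (half_lt_self hε)⟩
  have h := hN n hn
  rw [← hA, ← map_sub, ← enorm_eq_eSchattenNorm, ← ofReal_norm,
    ENNReal.ofReal_le_ofReal_iff (by positivity)] at h
  rwa [dist_comm, dist_eq_norm]

/-- A rank one projection is a nonzero element. -/
instance [Nontrivial H] : Nontrivial (SchattenClass p H) := by
  obtain ⟨v, hv⟩ := exists_norm_eq H zero_le_one
  obtain ⟨A, hA⟩ := exists_toOp_eq (eSchattenNorm_rankOne_lt_top (Fact.out : 1 ≤ p) hv)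
  refine ⟨A, 0, fun h0 => ?_⟩
  have h1 := congrArg (fun T : H →L[ℂ] H => T v) hA
  rw [h0, map_zero] at h1
  simp [hv, inner_self_eq_norm_sq_to_K] at h1
  simp [← h1] at hv

/-! ### Linear maps in the Schatten class -/

theorem enorm_apply_le (φ : SchattenClass p H →ₗ[ℂ] SchattenClass p H) (A : SchattenClass p H) :
    ‖φ A‖ₑ ≤ opENorm φ * ‖A‖ₑ := by
  by_cases hA : A = 0
  · simp [hA]
  have hn : (‖A‖ : ℂ) ≠ 0 := by exact_mod_cast norm_ne_zero_iff.mpr hA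
  have h1 : ‖φ ((‖A‖ : ℂ)⁻¹ • A)‖ₑ ≤ opENorm φ :=
    le_iSup₂_of_le (f := fun (A : SchattenClass p H) (_ : ‖A‖ ≤ 1) => ‖φ A‖ₑ) _
      (norm_smul_inv_norm hA).le le_rfl
  calc ‖φ A‖ₑ = ‖φ ((‖A‖ : ℂ)⁻¹ • A)‖ₑ * ‖A‖ₑ := by
        conv_lhs => rw [← smul_inv_smul₀ hn A, map_smul, enorm_smul, mul_comm]
        congr 1
        rw [← ofReal_norm, ← ofReal_norm, Complex.norm_real, norm_norm]
    _ ≤ _ := by gcongr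

theorem opENorm_toLinearMap (Φ : SchattenClass p H →L[ℂ] SchattenClass p H) :
    opENorm (Φ : SchattenClass p H →ₗ[ℂ] SchattenClass p H) = ‖Φ‖ₑ := by
  have hle : opENorm (Φ : SchattenClass p H →ₗ[ℂ] SchattenClass p H) ≤ ‖Φ‖ₑ := by
    refine iSup₂_le fun A hA => ?_
    rw [← ofReal_norm, ← ofReal_norm]
    exact ENNReal.ofReal_le_ofReal (Φ.unit_le_opNorm A hA)
  refine le_antisymm hle ?_
  have hfin := ne_top_of_le_ne_top enorm_ne_top hle
  rw [← ofReal_norm]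
  refine ENNReal.ofReal_le_of_le_toReal (Φ.opNorm_le_bound ENNReal.toReal_nonneg fun A => ?_)
  have h := ENNReal.toReal_mono (ENNReal.mul_ne_top hfin enorm_ne_top)
    (enorm_apply_le (Φ : SchattenClass p H →ₗ[ℂ] SchattenClass p H) A)
  rwa [ENNReal.toReal_mul, toReal_enorm, toReal_enorm] at h

theorem specRadius_toLinearMap (Φ : SchattenClass p H →L[ℂ] SchattenClass p H) :
    specRadius (Φ : SchattenClass p H →ₗ[ℂ] SchattenClass p H) = spectralRadius ℂ Φ := by
  rw [← (spectrum.pow_nnnorm_pow_one_div_tendsto_nhds_spectralRadius Φ).limsup_eq, specRadius]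
  congr! 3 with n
  rw [← ContinuousLinearMap.toLinearMap_pow, opENorm_toLinearMap]
  rfl

theorem exists_hasEigenvalue_of_isCompactOperator [Nontrivial H]
    {φ : SchattenClass p H →ₗ[ℂ] SchattenClass p H} (hc : IsCompactOperator φ)
    (h0 : specRadius φ ≠ 0) :
    ∃ l : ℂ, ‖l‖ₑ = specRadius φ ∧ Module.End.HasEigenvalue φ l := by
  obtain ⟨Φ, rfl⟩ : ∃ Φ : SchattenClass p H →L[ℂ] SchattenClass p H, Φ.toLinearMap = φ :=
    ⟨⟨φ, hc.continuous⟩, rfl⟩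
  obtain ⟨l, hl, hr⟩ := spectrum.exists_nnnorm_eq_spectralRadius Φ
  rw [specRadius_toLinearMap] at h0 ⊢
  refine ⟨l, hr, ?_⟩
  have hl0 : l ≠ 0 := by
    rintro rfl
    exact h0 (by rw [← hr]; simp)
  exact (IsCompactOperator.hasEigenvalue_iff_mem_spectrum hc hl0).mpr hl

theorem abs_ne_zero {A : SchattenClass p H} (hA : A ≠ 0) : A.abs ≠ 0 := by
  intro h
  apply hA
  have h1 : CFC.abs (toOp A) = 0 := by rw [← toOp_abs, h, map_zero]
  refine toOp_injective ?_
  rw [map_zero]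
  ext x
  rw [zero_apply, ← norm_eq_zero, ← norm_abs_apply, h1, zero_apply, norm_zero]

/-- An eigenvector `A` of a 2-positive map for an eigenvalue `l` of modulus `‖φ‖_p` yields the
eigenvector `|A|` for `|l|`: `eq_smul_abs_of_block` applied to the image of the block operator
`(|A⋆|, A; A⋆, |A|)`. -/
theorem apply_abs_of_apply_eq_smul {φ : SchattenClass p H →ₗ[ℂ] SchattenClass p H}
    (h2pos : IsNPositive 2 φ) {l : ℂ} (hl : ‖l‖ₑ = opENorm φ) {A : SchattenClass p H}
    (hA : φ A = l • A) : φ A.abs = (‖l‖ : ℂ) • A.abs := by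
  have hp : 1 ≤ p := Fact.out
  rcases eq_or_ne l 0 with rfl | hl0
  · have h := enorm_apply_le φ A.abs
    rw [← hl] at h
    simpa using h
  have hAtop := eSchattenNorm_lt_top A
  obtain ⟨A', hA'⟩ := exists_toOp_eq ((eSchattenNorm_star_le hp (toOp A)).trans_lt hAtop)
  have hbound : ∀ X : SchattenClass p H, eSchattenNorm p (toOp X) ≤ eSchattenNorm p (toOp A) →
      eSchattenNorm p (toOp (φ X)) ≤ ‖l‖ₑ * eSchattenNorm p (toOp A) := fun X hX => by
    rw [← enorm_eq_eSchattenNorm]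
    refine (enorm_apply_le φ X).trans ?_
    rw [hl, enorm_eq_eSchattenNorm]
    gcongr
  have hblock : BlockNonneg !![A'.abs, A; A', A.abs] := fun x => by
    have h := abs_block_nonneg (isCompactOperator_of_eSchattenNorm
      (lt_of_lt_of_le one_pos hp) hAtop) (x 0) (x 1)
    simpa [Fin.sum_univ_two, hA'] using h
  have h := h2pos _ hblock
  refine toOp_injective ?_
  rw [map_smul, toOp_abs]
  refine eq_smul_abs_of_block hp hl0 (C := toOp (φ A')) (Q := toOp (φ A'.abs)) (fun x y => ?_)
    hAtop (hbound _ ?_) (hbound _ ?_)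
  · have h1 := h ![x, y]
    simpa [Fin.sum_univ_two, hA] using h1
  · rw [toOp_abs, eSchattenNorm_abs]
  · rw [toOp_abs, eSchattenNorm_abs, hA']
    exact eSchattenNorm_star_le hp _

end SchattenClass

theorem theorem4p1 {H : Type*} [NormedAddCommGroup H] [InnerProductSpace ℂ H] [CompleteSpace H]
    [TopologicalSpace.SeparableSpace H] [Nontrivial H] (p : ℝ) [Fact (1 ≤ p)]
    (φ : SchattenClass p H →ₗ[ℂ] SchattenClass p H)
    (h2pos : SchattenClass.IsNPositive 2 φ)
    (hr : SchattenClass.specRadius φ = SchattenClass.opENorm φ) :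
    (∀ (l : ℂ) (A : SchattenClass p H), ‖l‖ₑ = SchattenClass.specRadius φ →
        Module.End.HasEigenvector φ l A →
        Module.End.HasEigenvector φ ((SchattenClass.specRadius φ).toReal : ℂ) A.abs) ∧
      (IsCompactOperator φ →
        Module.End.HasEigenvalue φ ((SchattenClass.specRadius φ).toReal : ℂ)) := by
  have part1 : ∀ (l : ℂ) (A : SchattenClass p H), ‖l‖ₑ = SchattenClass.specRadius φ →
      Module.End.HasEigenvector φ l A →
      Module.End.HasEigenvector φ ((SchattenClass.specRadius φ).toReal : ℂ) A.abs := by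
    intro l A hl hA
    refine ⟨Module.End.mem_eigenspace_iff.mpr ?_, SchattenClass.abs_ne_zero hA.2⟩
    rw [← hl, toReal_enorm]
    exact SchattenClass.apply_abs_of_apply_eq_smul h2pos (hl.trans hr) hA.apply_eq_smul
  refine ⟨part1, fun hc => ?_⟩
  by_cases h0 : SchattenClass.specRadius φ = 0
  · -- Here `‖φ‖ = 0`, so that `φ = 0`.
    obtain ⟨A, hA⟩ := exists_ne (0 : SchattenClass p H)
    refine Module.End.hasEigenvalue_of_hasEigenvector (x := A)
      ⟨Module.End.mem_eigenspace_iff.mpr ?_, hA⟩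
    have h := SchattenClass.enorm_apply_le φ A
    rw [← hr, h0] at h
    simpa [h0] using h
  · obtain ⟨l, hl, hev⟩ := SchattenClass.exists_hasEigenvalue_of_isCompactOperator hc h0
    obtain ⟨A, hA⟩ := hev.exists_hasEigenvector
    exact Module.End.hasEigenvalue_of_hasEigenvector (part1 l A hl hA)
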